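/- Let $C(\mathbb{R})$ be the space of continuous functions $\mathbb{R}\to\mathbb{R}$ with the compact-open topology, and let $d_\infty(f,g)=\sup_{x\in\mathbb{R}}|f(x)-g(x)|\in[0,\infty]$. Let $E_\infty$ be the equivalence relation on $C(\mathbb{R})$ given by $f\,E_\infty\,g\iff d_\infty(f,g)<\infty$ (that is, $f-g$ is bounded), and let $\mathcal{V}$ be the uniformity on $C(\mathbb{R})$ with base $\{(f,g): d_\infty(f,g)<\varepsilon\}$, $\varepsilon>0$. Then the following hold. (i) $d_\infty$ is turbulent: every $E_\infty$-class is dense in $C(\mathbb{R})$; every $E_\infty$-class is meager in $C(\mathbb{R})$; and for every open $U\subset C(\mathbb{R})$, every $V\in\mathcal{V}$ with $V\subset E_\infty$ and every $f\in U$, the local equivalence class of $f$ (the set of all endpoints of finite chains $f=f_0,f_1,\dots,f_n$, $n\ge 0$, in $U$ with $(f_{i-1},f_i)\in V$ for $1\le i\le n$) is somewhere dense, i.e. its closure in $C(\mathbb{R})$ has non-empty interior. (ii) Let $S_\infty$ be the group of all permutations of $\mathbb{N}$ with the topology of pointwise convergence, and let $Y$ be a Polish $S_\infty$-space, i.e.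 a Polish space with a continuous action of $S_\infty$, with orbit equivalence relation $E^Y_{S_\infty}$. Then $E_\infty$ is generically $E^Y_{S_\infty}$-ergodic: for every map $\theta:C(\mathbb{R})\to Y$ such that $\theta^{-1}(O)$ has the Baire property for every open $O\subset Y$ and such that $f\,E_\infty\,g$ implies $\theta(f)\,E^Y_{S_\infty}\,\theta(g)$, there is a residual $E_\infty$-saturated set $C\subset C(\mathbb{R})$ such that $\theta(C)$ is contained in a single $S_\infty$-orbit. (iii) For every Polish group $G$ and every Polish space $Y$ with a continuous action of $G$, with orbit equivalence relation $E^Y_G$, $E_\infty$ is not Borel reducible to $E^Y_G$: there is no Borel map $\theta:C(\mathbb{R})\to Y$ such that $f\,E_\infty\,g\iff\theta(f)\,E^Y_G\,\theta(g)$ for all $f,g\in C(\mathbb{R})$. -/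

import Mathlib

open Set Filter Topology Uniformity
open scoped ENNReal

/-! ### Equivalence relations over topological spaces -/

/-- A map `θ` is `(E, F)`-invariant if `x E x'` implies `θ x F θ x'`. -/
def IsInvariantMap {X Y : Type*} (E : Setoid X) (F : Setoid Y) (θ : X → Y) : Prop :=
  ∀ x x' : X, E x x' → F (θ x) (θ x')

/-- A map is Borel if the preimage of every Borel set is a Borel set. -/
def IsBorelMap {X Y : Type*} [TopologicalSpace X] [TopologicalSpace Y] (θ : X → Y) : Prop :=
  @Measurable X Y (borel X) (borel Y) θ

/-- A map is Baire measurable if the preimage of every open set has the Baire property. -/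
def IsBaireMeasurableMap {X Y : Type*} [TopologicalSpace X] [TopologicalSpace Y]
    (θ : X → Y) : Prop :=
  ∀ U : Set Y, IsOpen U → BaireMeasurableSet (θ ⁻¹' U)

/-- `E ≤_B F`: there is an `(E, F)`-invariant Borel map `θ : X → Y` whose induced map
`X / E → Y / F` is injective. -/
def BorelReducible {X Y : Type*} [TopologicalSpace X] [TopologicalSpace Y]
    (E : Setoid X) (F : Setoid Y) : Prop :=
  ∃ θ : X → Y, IsBorelMap θ ∧
    ∃ hθ : IsInvariantMap E F θ, Function.Injective (Quotient.map (sa := E) (sb := F) θ hθ)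

/-- `E` is generically `F`-ergodic: for every `(E, F)`-invariant Baire measurable `θ : X → Y`
there is a residual `E`-saturated set `C` such that the map induced by `θ` from the `E`-classes
in `C` to the `F`-classes is constant. -/
def GenericallyErgodic {X Y : Type*} [TopologicalSpace X] [TopologicalSpace Y]
    (E : Setoid X) (F : Setoid Y) : Prop :=
  ∀ θ : X → Y, IsInvariantMap E F θ → IsBaireMeasurableMap θ →
    ∃ C : Set X, C ∈ residual X ∧ (∀ x ∈ C, ∀ x', E x x' → x' ∈ C) ∧
      ∀ x ∈ C, ∀ x' ∈ C, F (θ x) (θ x')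

/-- The group `S_∞` of all permutations of the natural numbers. -/
abbrev SInfty : Type := Equiv.Perm ℕ

/-- The topology of `S_∞`: the one induced by the product topology of `ℕ^ℕ`, where `ℕ` is
discrete. -/
instance SInfty.topologicalSpace : TopologicalSpace SInfty :=
  TopologicalSpace.induced (fun (g : SInfty) (n : ℕ) => g n) inferInstance

/-! ### Uniform relations, metric relations and turbulence -/

/-- A uniform equivalence relation over a set `X`: a uniformity on `X` together with an
equivalence relation over `X` that is one of its entourages. If `X` is also a topological space,
its topology need not be the one that the uniformity induces. -/
structure UniformRelation (X : Type*) where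
  /-- the uniformity -/
  uniformity : UniformSpace X
  /-- the equivalence relation -/
  rel : Setoid X
  /-- the equivalence relation is an entourage -/
  rel_mem : {p : X × X | rel p.1 p.2} ∈ 𝓤[uniformity]

/-- The local equivalence class `E(x, U, V)` of `x ∈ U`: the set of points that can be joined to
`x` by a finite (possibly trivial) chain of points of `U` whose consecutive terms are related
by `V`. -/
def localClass {X : Type*} (V : Set (X × X)) (U : Set X) (x : X) : Set X :=
  {y | Relation.ReflTransGen (fun a b => (a, b) ∈ V ∧ a ∈ U ∧ b ∈ U) x y}

/-- A uniform relation over a topological space is turbulent if every equivalence class is dense,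
every equivalence class is meager, and every local equivalence class is somewhere dense. -/
structure UniformRelation.IsTurbulent {X : Type*} [TopologicalSpace X]
    (R : UniformRelation X) : Prop where
  dense_class : ∀ x, Dense {y | R.rel x y}
  meagre_class : ∀ x, IsMeagre {y | R.rel x y}
  somewhere_dense_localClass :
    ∀ (U : Set X) (V : Set (X × X)), IsOpen U → V ∈ 𝓤[R.uniformity] →
      V ⊆ {p | R.rel p.1 p.2} → ∀ x ∈ U, (interior (closure (localClass V U x))).Nonempty

/-- The equivalence relation `E_d^X` of a metric `d` with possible infinite values:
`x` and `y` are equivalent if and only if `d(x, y) < ∞`. -/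
def EMetricSpace.finiteDistRel {X : Type*} (d : EMetricSpace X) : Setoid X where
  r x y := d.edist x y < ∞
  iseqv :=
    { refl := fun x => by rw [d.edist_self]; exact ENNReal.zero_lt_top
      symm := fun {x y} h => by rw [d.edist_comm]; exact h
      trans := fun {x y z} h h' =>
        lt_of_le_of_lt (d.edist_triangle x y z) (ENNReal.add_lt_top.2 ⟨h, h'⟩) }

/-- The uniform relation induced by a metric `d` with possible infinite values: the sets
`{(x, y) | d(x, y) < ε}`, `ε > 0`, form a base of the uniformity. -/
def EMetricSpace.toUniformRelation {X : Type*} (d : EMetricSpace X) : UniformRelation X where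
  uniformity := d.toUniformSpace
  rel := d.finiteDistRel
  rel_mem := by
    rw [d.uniformity_edist]
    exact mem_iInf_of_mem ∞ (mem_iInf_of_mem ENNReal.zero_lt_top (mem_principal_self _))

/-! ### The supremum metric relation -/

/-- The supremum metric `d_∞(f, g) = sup_{x ∈ ℝ} |f x - g x| ∈ [0, ∞]` on `C(ℝ)`. It is not an
instance: the topology of `C(ℝ)` remains the compact-open topology. -/
@[reducible]
noncomputable def supMetric : EMetricSpace C(ℝ, ℝ) where
  edist f g := ⨆ x : ℝ, ENNReal.ofReal |f x - g x|
  edist_self f := by simp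
  edist_comm f g := by simp only [abs_sub_comm]
  edist_triangle f g h := by
    refine iSup_le fun x => ?_
    calc ENNReal.ofReal |f x - h x| ≤ ENNReal.ofReal (|f x - g x| + |g x - h x|) :=
          ENNReal.ofReal_le_ofReal (abs_sub_le _ _ _)
      _ = ENNReal.ofReal |f x - g x| + ENNReal.ofReal |g x - h x| :=
          ENNReal.ofReal_add (abs_nonneg _) (abs_nonneg _)
      _ ≤ _ := add_le_add (le_iSup (fun y : ℝ => ENNReal.ofReal |f y - g y|) x)
          (le_iSup (fun y : ℝ => ENNReal.ofReal |g y - h y|) x)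
  eq_of_edist_eq_zero {f g} hfg := by
    ext x
    have h0 : ENNReal.ofReal |f x - g x| = 0 := ENNReal.iSup_eq_zero.1 hfg x
    have h1 : |f x - g x| ≤ 0 := ENNReal.ofReal_eq_zero.1 h0
    exact sub_eq_zero.1 (abs_nonpos_iff.1 h1)

/-!
Bounded functions are dense in `C(ℝ)`, so the classes of `d_∞` are dense, and a class is meagre
because it is a union of countably many closed sets that miss another class. Local classes are
somewhere dense because `C(ℝ)` is locally convex: a segment between two points at finite distance
can be cut into arbitrarily short steps.

For generic ergodicity, the restrictions to `ℝ` of continuous functions on `[-∞, ∞]` form a dense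
Banach space of bounded functions acting on `C(ℝ)` by translations. By Kuratowski–Ulam and
non-meagreness, a small generic translation moves `θ x` by an element of a given open subgroup, and
Hjorth's back-and-forth construction then joins any two generic values of `θ` by an element of
the non-archimedean group.

Eventual equality of real sequences reduces to `E_∞`, and by the theorem of Kechris and Louveau it
does not reduce to an orbit equivalence relation of a Polish group.
-/
section DependentChoice

theorem exists_seq_of_forall_exists_step {α : Type*} (p : ℕ → α → Prop) (r : ℕ → α → α → Prop)
    {a : α} (ha : p 0 a) (h : ∀ n x, p n x → ∃ y, p (n + 1) y ∧ r n x y) :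
    ∃ f : ℕ → α, f 0 = a ∧ (∀ n, p n (f n)) ∧ ∀ n, r n (f n) (f (n + 1)) := by
  choose! s hs hr using h
  have hp : ∀ n, p n (Nat.rec a s n) := by
    intro n
    induction n with
    | zero => exact ha
    | succ n ih => exact hs n _ ih
  exact ⟨fun n => Nat.rec a s n, rfl, hp, fun n => hr n _ (hp n)⟩

theorem exists_forall_res_of_forall_exists_cons {α : Type*} {p : List α → Prop} (hp : p [])
    (h : ∀ s, p s → ∃ a, p (a :: s)) : ∃ σ : ℕ → α, ∀ n, p (PiNat.res σ n) := by
  obtain ⟨l, hl0, hl, hstep⟩ := exists_seq_of_forall_exists_step (fun _ => p)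
    (fun _ s t => ∃ a, t = a :: s) hp fun _ s hs => by
      obtain ⟨a, ha⟩ := h s hs
      exact ⟨a :: s, ha, a, rfl⟩
  choose σ hσ using hstep
  have hres : ∀ n, PiNat.res σ n = l n := by
    intro n
    induction n with
    | zero => exact hl0.symm
    | succ n ih => rw [PiNat.res_succ, ih, hσ]
  exact ⟨σ, fun n => hres n ▸ hl n⟩

end DependentChoice

section BaireCategory

variable {X H : Type*} [TopologicalSpace X] [TopologicalSpace H]

theorem isOpen_section {O : Set (X × H)} (hO : IsOpen O) (x : X) : IsOpen {h | (x, h) ∈ O} :=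
  hO.preimage (Continuous.prodMk_right x)

theorem isOpen_setOf_exists_mem_section {O : Set (X × H)} (hO : IsOpen O) (V : Set H) :
    IsOpen {x | ∃ h ∈ V, (x, h) ∈ O} := by
  have hUnion : {x | ∃ h ∈ V, (x, h) ∈ O} = ⋃ h ∈ V, (fun x => (x, h)) ⁻¹' O := by ext; simp
  rw [hUnion]
  exact isOpen_biUnion fun h _ => hO.preimage (Continuous.prodMk_left h)

theorem eventually_dense_section [SecondCountableTopology H] {O : Set (X × H)} (hO : IsOpen O)
    (hd : Dense O) : ∀ᶠ x in residual X, Dense {h | (x, h) ∈ O} := by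
  have hmeet : ∀ b ∈ TopologicalSpace.countableBasis H,
      ∀ᶠ x in residual X, ∃ h ∈ b, (x, h) ∈ O := fun b hb => by
    refine residual_of_dense_open (isOpen_setOf_exists_mem_section hO b)
      (dense_iff_inter_open.2 fun U hU hUn => ?_)
    obtain ⟨⟨x, h⟩, ⟨hx, hh⟩, hxh⟩ := hd.inter_open_nonempty _
      (hU.prod (TopologicalSpace.isOpen_of_mem_countableBasis hb))
      (hUn.prod (TopologicalSpace.nonempty_of_mem_countableBasis hb))
    exact ⟨x, hx, h, hh, hxh⟩
  filter_upwards [(eventually_countable_ball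
    (TopologicalSpace.countable_countableBasis H)).2 hmeet] with x hx
  exact (TopologicalSpace.isBasis_countableBasis H).dense_iff.2 fun b hb _ => hx b hb

/-- The **Kuratowski–Ulam theorem**, in the direction that needs no Baire property. -/
theorem eventually_residual_section [SecondCountableTopology H] {p : X × H → Prop}
    (hp : ∀ᶠ z in residual (X × H), p z) :
    ∀ᶠ x in residual X, ∀ᶠ h in residual H, p (x, h) := by
  obtain ⟨S, hSo, hSd, hSc, hS⟩ := mem_residual_iff.1 hp
  filter_upwards [(eventually_countable_ball hSc).2 fun O hO =>
    eventually_dense_section (hSo O hO) (hSd O hO)] with x hx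
  filter_upwards [(eventually_countable_ball hSc).2 fun O hO =>
    residual_of_dense_open (isOpen_section (hSo O hO) x) (hx O hO)] with h hh
  exact hS (mem_sInter.2 hh)

theorem eventually_baireMeasurableSet_section [SecondCountableTopology H] {Q : Set (X × H)}
    (hQ : BaireMeasurableSet Q) : ∀ᶠ x in residual X, BaireMeasurableSet {h | (x, h) ∈ Q} := by
  obtain ⟨O, hO, hQO⟩ := hQ.residualEq_isOpen
  filter_upwards [eventually_residual_section (eventuallyEq_set.1 hQO)] with x hx
  exact (isOpen_section hO x).baireMeasurableSet.congr (eventuallyEq_set.2 (hx.mono fun _ => .symm))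

theorem eventually_residual_mem_imp_iff_subset_closure [BaireSpace X] {O V : Set X}
    (hO : IsOpen O) (hV : IsOpen V) :
    (∀ᶠ x in residual X, x ∈ V → x ∈ O) ↔ V ⊆ closure O := by
  refine ⟨fun h => ?_, fun h => ?_⟩
  · have hd : Dense {x | x ∈ V → x ∈ O} := dense_of_mem_residual h
    exact (hd.open_subset_closure_inter hV).trans (closure_mono fun x hx => hx.2 hx.1)
  · have hd : Dense (O ∪ (closure O)ᶜ) := by
      intro x
      by_cases hx : x ∈ closure O
      · exact closure_mono subset_union_left hx
      · exact subset_closure (Or.inr hx)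
    filter_upwards [residual_of_dense_open (hO.union isClosed_closure.isOpen_compl) hd]
      with x hx hxV
    exact hx.resolve_right fun hxO => hxO (h hxV)

theorem baireMeasurableSet_setOf_subset_closure_section [SecondCountableTopology H]
    {O : Set (X × H)} (hO : IsOpen O) {V : Set H} (hV : IsOpen V) :
    BaireMeasurableSet {x | V ⊆ closure {h | (x, h) ∈ O}} := by
  have hbasis : {x | V ⊆ closure {h | (x, h) ∈ O}} =
      ⋂ b ∈ {b ∈ TopologicalSpace.countableBasis H | (b ∩ V).Nonempty},
        {x | ∃ h ∈ b ∩ V, (x, h) ∈ O} := by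
    ext x
    simp only [mem_iInter, mem_ofPred_eq, and_imp]
    refine ⟨fun h b hb ⟨k, hkb, hkV⟩ => ?_, fun h k hkV => ?_⟩
    · obtain ⟨l, hl, hlO⟩ := mem_closure_iff.1 (h hkV) (b ∩ V)
        ((TopologicalSpace.isOpen_of_mem_countableBasis hb).inter hV) ⟨hkb, hkV⟩
      exact ⟨l, hl, hlO⟩
    · refine (TopologicalSpace.isBasis_countableBasis H).mem_closure_iff.2 fun b hb hkb => ?_
      obtain ⟨l, hl, hlO⟩ := h b hb ⟨k, hkb, hkV⟩
      exact ⟨l, hl.1, hlO⟩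
  rw [hbasis]
  exact .biInter ((TopologicalSpace.countable_countableBasis H).mono (sep_subset _ _))
    fun b _ => (isOpen_setOf_exists_mem_section hO _).baireMeasurableSet

theorem baireMeasurableSet_setOf_eventually_section [SecondCountableTopology H] [BaireSpace H]
    {Q : Set (X × H)} (hQ : BaireMeasurableSet Q) {V : Set H} (hV : IsOpen V) :
    BaireMeasurableSet {x | ∀ᶠ h in residual H, h ∈ V → (x, h) ∈ Q} := by
  obtain ⟨O, hO, hQO⟩ := hQ.residualEq_isOpen
  refine (baireMeasurableSet_setOf_subset_closure_section hO hV).congr (eventuallyEq_set.2 ?_)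
  filter_upwards [eventually_residual_section (eventuallyEq_set.1 hQO)] with x hx
  rw [← eventually_residual_mem_imp_iff_subset_closure (isOpen_section hO x) hV]
  exact eventually_congr (hx.mono fun h hh => imp_congr_right fun _ => hh.symm)

theorem exists_isOpen_eventually_mem_of_not_isMeagre {B : Set X} (hB : BaireMeasurableSet B)
    (h : ¬ IsMeagre B) : ∃ O, IsOpen O ∧ O.Nonempty ∧ ∀ᶠ x in residual X, x ∈ O → x ∈ B := by
  obtain ⟨O, hO, hBO⟩ := hB.residualEq_isOpen
  refine ⟨O, hO, nonempty_iff_ne_empty.2 ?_, (eventuallyEq_set.1 hBO).mono fun x hx => hx.2⟩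
  rintro rfl
  exact h ((eventuallyEq_set.1 hBO).mono fun x hx => hx.1)

theorem exists_isOpen_eventually_mem_of_subset_sUnion [BaireSpace X] {S : Set (Set X)}
    (hS : S.Countable) (hSm : ∀ A ∈ S, BaireMeasurableSet A) {V : Set X} (hV : IsOpen V)
    (hVn : V.Nonempty) (hVS : V ⊆ ⋃₀ S) :
    ∃ A ∈ S, ∃ O, IsOpen O ∧ O.Nonempty ∧ ∀ᶠ x in residual X, x ∈ O → x ∈ V ∧ x ∈ A := by
  obtain ⟨A, hA, hVA⟩ : ∃ A ∈ S, ¬ IsMeagre (V ∩ A) := by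
    by_contra! hmeagre
    refine not_isMeagre_of_isOpen hV hVn ((isMeagre_biUnion hS hmeagre).mono fun x hx => ?_)
    obtain ⟨A, hA, hxA⟩ := hVS hx
    exact mem_iUnion₂.2 ⟨A, hA, hx, hxA⟩
  exact ⟨A, hA, exists_isOpen_eventually_mem_of_not_isMeagre
    (hV.baireMeasurableSet.inter (hSm A hA)) hVA⟩

theorem exists_maximal_isOpen_isMeagre_inter [SecondCountableTopology X] (A : Set X) :
    ∃ U, IsOpen U ∧ IsMeagre (A ∩ U) ∧ ∀ O, IsOpen O → IsMeagre (A ∩ O) → O ⊆ U := by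
  set S := {b ∈ TopologicalSpace.countableBasis X | IsMeagre (A ∩ b)}
  have hS : S.Countable := (TopologicalSpace.countable_countableBasis X).mono (sep_subset _ _)
  refine ⟨⋃₀ S, isOpen_sUnion fun b hb => TopologicalSpace.isOpen_of_mem_countableBasis hb.1,
    ?_, fun O hO hAO x hx => ?_⟩
  · rw [sUnion_eq_biUnion, inter_iUnion₂]
    exact isMeagre_biUnion hS fun b hb => hb.2
  · obtain ⟨b, hb, hxb, hbO⟩ :=
      (TopologicalSpace.isBasis_countableBasis X).exists_subset_of_mem_open hx hO
    exact ⟨b, ⟨hb, hAO.mono (inter_subset_inter_right A hbO)⟩, hxb⟩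

theorem exists_baireMeasurableSet_hull [SecondCountableTopology X] (A : Set X) :
    ∃ B, BaireMeasurableSet B ∧ A ⊆ B ∧
      ∀ C, BaireMeasurableSet C → A ⊆ C → IsMeagre (B \ C) := by
  obtain ⟨U, hU, hAU, hmax⟩ := exists_maximal_isOpen_isMeagre_inter A
  refine ⟨Uᶜ ∪ A ∩ U, hU.baireMeasurableSet.compl.union hAU.baireMeasurableSet,
    fun x hx => (em (x ∈ U)).elim (fun h => Or.inr ⟨hx, h⟩) Or.inl, fun C hC hAC => ?_⟩
  obtain ⟨O, hO, hCO⟩ := hC.compl.residualEq_isOpen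
  have hOU : O ⊆ U := hmax O hO ((eventuallyEq_set.1 hCO).mono fun x hx hxAO =>
    hx.2 hxAO.2 (hAC hxAO.1))
  filter_upwards [eventuallyEq_set.1 hCO, hAU] with x hx hxAU
  rintro ⟨hxU | hxAU', hxC⟩
  · exact hxU (hOU (hx.1 hxC))
  · exact hxAU hxAU'

/-- **Nikodym's theorem** on the Suslin operation. -/
theorem baireMeasurableSet_iUnion_iInter_res [SecondCountableTopology X] {α : Type*} [Countable α]
    {F : List α → Set X} (hF : ∀ s, BaireMeasurableSet (F s)) :
    BaireMeasurableSet (⋃ σ : ℕ → α, ⋂ n, F (PiNat.res σ n)) := by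
  set P : List α → Set X := fun s =>
    {x | ∃ σ : ℕ → α, PiNat.res σ s.length = s ∧ ∀ n, x ∈ F (PiNat.res σ n)} with hP
  choose B hBm hPB hB using fun s => exists_baireMeasurableSet_hull (P s)
  set C : List α → Set X := fun s => B s ∩ F s
  have hCm : ∀ s, BaireMeasurableSet (C s) := fun s => (hBm s).inter (hF s)
  have hPC : ∀ s, P s ⊆ C s := fun s x hx => by
    refine ⟨hPB s hx, ?_⟩
    obtain ⟨σ, hσ, hxσ⟩ := hx
    exact hσ ▸ hxσ s.length
  have hPcons : ∀ s, P s ⊆ ⋃ a, C (a :: s) := by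
    rintro s x ⟨σ, hσ, hxσ⟩
    refine mem_iUnion.2 ⟨σ s.length, hPC _ ⟨σ, ?_, hxσ⟩⟩
    rw [List.length_cons, PiNat.res_succ, hσ]
  have hloss : ∀ s, IsMeagre (C s \ ⋃ a, C (a :: s)) := fun s =>
    (hB s _ (.iUnion fun a => hCm (a :: s)) (hPcons s)).mono
      (sdiff_subset_sdiff_left inter_subset_left)
  have hbranch : C [] \ P [] ⊆ ⋃ s, C s \ ⋃ a, C (a :: s) := by
    rintro x ⟨hx, hxP⟩
    by_contra hcon
    simp only [mem_iUnion, Set.mem_sdiff, not_exists, not_and, not_forall, not_not] at hcon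
    obtain ⟨σ, hσ⟩ := exists_forall_res_of_forall_exists_cons (p := fun s => x ∈ C s) hx hcon
    exact hxP ⟨σ, rfl, fun n => (hσ n).2⟩
  have hP0 : ⋃ σ : ℕ → α, ⋂ n, F (PiNat.res σ n) = P [] := by ext x; simp [hP]
  rw [hP0, ← sdiff_sdiff_cancel_left (hPC [])]
  exact (hCm []).diff ((isMeagre_iUnion hloss).mono hbranch).baireMeasurableSet

end BaireCategory

section BaireMeasurableMaps

variable {X Y : Type*} [TopologicalSpace X] [TopologicalSpace Y]

theorem eq_of_forall_mem_closure_image_cylinder [T2Space Y] {E : ℕ → Type*}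
    [∀ n, TopologicalSpace (E n)] [∀ n, DiscreteTopology (E n)] {f : (∀ n, E n) → Y}
    {σ : ∀ n, E n} (hf : ContinuousAt f σ) {y : Y}
    (hy : ∀ n, y ∈ closure (f '' PiNat.cylinder σ n)) : f σ = y := by
  by_contra hne
  obtain ⟨u, v, hu, hv, hσu, hyv, huv⟩ := t2_separation hne
  obtain ⟨_, ⟨τ, n, rfl⟩, hσ, hτ⟩ := (PiNat.isTopologicalBasis_cylinders E).mem_nhds_iff.1
    (hf (hu.mem_nhds hσu))
  obtain ⟨_, hρv, ρ, hρ, rfl⟩ := mem_closure_iff.1 (hy n) v hv hyv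
  rw [PiNat.mem_cylinder_iff_eq.1 hσ] at hρ
  exact disjoint_left.1 huv (hτ hρ) hρv

namespace IsBaireMeasurableMap

theorem preimage_analyticSet [SecondCountableTopology X] [T2Space Y] {θ : X → Y}
    (hθ : IsBaireMeasurableMap θ) {A : Set Y} (hA : MeasureTheory.AnalyticSet A) :
    BaireMeasurableSet (θ ⁻¹' A) := by
  rw [MeasureTheory.AnalyticSet] at hA
  rcases hA with rfl | ⟨f, hf, rfl⟩
  · exact isOpen_empty.baireMeasurableSet
  set N : List ℕ → Set (ℕ → ℕ) := fun s => {σ | PiNat.res σ s.length = s}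
  have hN : ∀ σ n, N (PiNat.res σ n) = PiNat.cylinder σ n := fun σ n => by
    simp only [N, PiNat.res_length, PiNat.cylinder_eq_res]
  have hrange : θ ⁻¹' range f =
      ⋃ σ : ℕ → ℕ, ⋂ n, θ ⁻¹' closure (f '' N (PiNat.res σ n)) := by
    ext x
    simp only [mem_preimage, mem_range, mem_iUnion, mem_iInter, hN]
    refine exists_congr fun σ => ⟨fun hx n => ?_, fun hx =>
      eq_of_forall_mem_closure_image_cylinder hf.continuousAt hx⟩
    exact subset_closure ⟨σ, PiNat.self_mem_cylinder σ n, hx⟩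
  rw [hrange]
  exact baireMeasurableSet_iUnion_iInter_res
    (F := fun s => θ ⁻¹' closure (f '' N s)) fun s => .of_compl (hθ _ isClosed_closure.isOpen_compl)

theorem exists_residual_continuousOn [SecondCountableTopology Y]
    {θ : X → Y} (hθ : IsBaireMeasurableMap θ) : ∃ C ∈ residual X, ContinuousOn θ C := by
  choose! O hO hθO using fun U (hU : U ∈ TopologicalSpace.countableBasis Y) =>
    (hθ U (TopologicalSpace.isOpen_of_mem_countableBasis hU)).residualEq_isOpen
  refine ⟨_, (eventually_countable_ball (TopologicalSpace.countable_countableBasis Y)).2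
    fun U hU => eventuallyEq_set.1 (hθO U hU), fun x hx => ?_⟩
  refine ((TopologicalSpace.isBasis_countableBasis Y).nhds_hasBasis).tendsto_right_iff.2 ?_
  rintro U ⟨hU, hxU⟩
  filter_upwards [self_mem_nhdsWithin,
    mem_nhdsWithin_of_mem_nhds ((hO U hU).mem_nhds ((hx U hU).1 hxU))] with y hy hyO
  exact (hy U hU).2 hyO

theorem comp_isOpenMap {Z : Type*} [TopologicalSpace Z] {θ : X → Y}
    (hθ : IsBaireMeasurableMap θ) {m : Z → X} (hm : Continuous m) (hm' : IsOpenMap m) :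
    IsBaireMeasurableMap (θ ∘ m) :=
  fun U hU => (hθ U hU).preimage hm hm'

theorem prodMk {Z : Type*} [TopologicalSpace Z] [SecondCountableTopology Z] {θ : X → Y}
    {η : X → Z} (hθ : IsBaireMeasurableMap θ) (hη : IsBaireMeasurableMap η) :
    IsBaireMeasurableMap fun x => (θ x, η x) := by
  let _ : MeasurableSpace X := eventuallyMeasurableSpace (borel _) (residual _)
  borelize Y Z
  have hθm : Measurable θ := measurable_of_isOpen hθ
  have hηm : Measurable η := measurable_of_isOpen hη
  exact fun U hU => (hθm.prodMk hηm) hU.measurableSet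

end IsBaireMeasurableMap

theorem IsBorelMap.isBaireMeasurableMap {θ : X → Y} (hθ : IsBorelMap θ) :
    IsBaireMeasurableMap θ := by
  intro U hU
  borelize X Y
  exact (hθ hU.measurableSet).baireMeasurableSet

end BaireMeasurableMaps

section Shifts

variable {X H : Type*} [AddGroup X] [TopologicalSpace X] [IsTopologicalAddGroup X]
  [AddGroup H] [TopologicalSpace H]

theorem isOpenMap_add_map {ι : H →+ X} (hι : Continuous ι) :
    IsOpenMap fun z : X × H => z.1 + ι z.2 := by
  let e : X × H ≃ₜ X × H :=
    { toFun := fun z => (z.1 + ι z.2, z.2)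
      invFun := fun z => (z.1 - ι z.2, z.2)
      left_inv := fun z => by simp
      right_inv := fun z => by simp
      continuous_toFun := by fun_prop
      continuous_invFun := by fun_prop }
  exact isOpenMap_fst.comp e.isOpenMap

theorem eventually_residual_add_map [SecondCountableTopology H] {ι : H →+ X} (hι : Continuous ι)
    {p : X → Prop} (hp : ∀ᶠ x in residual X, p x) :
    ∀ᶠ x in residual X, ∀ᶠ h in residual H, p (x + ι h) :=
  eventually_residual_section (p := fun z : X × H => p (z.1 + ι z.2))
    ((tendsto_residual_of_isOpenMap (by fun_prop) (isOpenMap_add_map hι)).eventually hp)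

theorem exists_residual_subset_eventually_add_mem [SecondCountableTopology H] {I : Type*}
    [Countable I] (ι : I → H →+ X) (hι : ∀ i, Continuous (ι i)) {C : Set X}
    (hC : C ∈ residual X) :
    ∃ C' ∈ residual X, C' ⊆ C ∧ ∀ x ∈ C', ∀ i, ∀ᶠ h in residual H, x + ι i h ∈ C' := by
  set D : ℕ → Set X := fun n =>
    Nat.rec C (fun _ S => {x ∈ S | ∀ i, ∀ᶠ h in residual H, x + ι i h ∈ S}) n
  have hres : ∀ n, D n ∈ residual X := by
    intro n
    induction n with
    | zero => exact hC
    | succ n ih =>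
      exact inter_mem ih
        (eventually_countable_forall.2 fun i => eventually_residual_add_map (hι i) ih)
  refine ⟨⋂ n, D n, countable_iInter_mem.2 hres, iInter_subset D 0, fun x hx i => ?_⟩
  simp only [mem_iInter] at hx ⊢
  exact eventually_countable_forall.2 fun n => (hx (n + 1)).2 i

end Shifts

section LocalControl

theorem exists_countable_isOpen_cover_div_mem {G : Type*} [Group G] [TopologicalSpace G]
    [IsTopologicalGroup G] [SecondCountableTopology G] {W : Set G} (hW : W ∈ 𝓝 1) :
    ∃ S : Set (Set G), S.Countable ∧ ⋃₀ S = univ ∧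
      ∀ M ∈ S, IsOpen M ∧ ∀ a ∈ M, ∀ b ∈ M, a / b ∈ W := by
  refine ⟨{M ∈ TopologicalSpace.countableBasis G | ∀ a ∈ M, ∀ b ∈ M, a / b ∈ W},
    (TopologicalSpace.countable_countableBasis G).mono (sep_subset _ _),
    eq_univ_of_forall fun g => ?_,
    fun M hM => ⟨TopologicalSpace.isOpen_of_mem_countableBasis hM.1, hM.2⟩⟩
  have hdiv : Tendsto (fun p : G × G => p.1 / p.2) (𝓝 g ×ˢ 𝓝 g) (𝓝 1) :=
    div_self' g ▸ tendsto_fst.div' tendsto_snd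
  obtain ⟨M, ⟨hM, hgM⟩, hMW⟩ :=
    (TopologicalSpace.isBasis_countableBasis G).nhds_hasBasis.prod_self.mem_iff.1 (hdiv hW)
  exact ⟨M, ⟨hM, fun a ha b hb => hMW (mk_mem_prod ha hb)⟩, hgM⟩

theorem analyticSet_setOf_exists_mem_eq_smul {G Y : Type*} [TopologicalSpace G] [PolishSpace G]
    [TopologicalSpace Y] [PolishSpace Y] [SMul G Y] [ContinuousSMul G Y] {W : Set G}
    (hW : IsOpen W) : MeasureTheory.AnalyticSet {p : Y × Y | ∃ g ∈ W, p.2 = g • p.1} := by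
  have himage : {p : Y × Y | ∃ g ∈ W, p.2 = g • p.1} =
      (fun q : G × Y => (q.2, q.1 • q.2)) '' (W ×ˢ univ) := by
    ext ⟨y, y'⟩
    simp only [mem_ofPred_eq, mem_image, mem_prod, mem_univ, and_true, Prod.mk.injEq, Prod.exists]
    exact ⟨fun ⟨g, hg, h⟩ => ⟨g, y, hg, rfl, h.symm⟩,
      fun ⟨g, _, hg, hy, h⟩ => ⟨g, hg, hy ▸ h.symm⟩⟩
  rw [himage]
  exact (hW.prod isOpen_univ).analyticSet_image (by fun_prop)

/-- The points `x` that are controlled by `W` on the scale `V`: for generic `h ∈ V`, shifting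
`x` by `ι h` moves `θ x` by an element of `W`. -/
def genericShiftSet {X H G Y : Type*} [Add X] [TopologicalSpace H] [SMul G Y] (ι : H → X)
    (θ : X → Y) (W : Set G) (V : Set H) : Set X :=
  {x | ∀ᶠ h in residual H, h ∈ V → ∃ g ∈ W, θ (x + ι h) = g • θ x}

theorem genericShiftSet_subset {X H G Y : Type*} [Add X] [TopologicalSpace H] [SMul G Y]
    {ι : H → X} {θ : X → Y} {W W' : Set G} {V V' : Set H} (hW : W ⊆ W') (hV : V' ⊆ V) :
    genericShiftSet ι θ W V ⊆ genericShiftSet ι θ W' V' := by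
  intro x hx
  simp only [genericShiftSet, mem_ofPred_eq] at hx ⊢
  exact hx.mono fun h hh hhV => (hh (hV hhV)).imp fun g hg => ⟨hW hg.1, hg.2⟩

/-- `θ` is locally controlled on `C`: near each point of `C`, one scale of shifts serves all
points of `C` for a given neighbourhood of the identity of `G`. -/
def LocallyControlledOn {X H Y : Type*} (G : Type*) [Add X] [TopologicalSpace X] [Zero H]
    [TopologicalSpace H] [One G] [TopologicalSpace G] [SMul G Y] (ι : H → X) (θ : X → Y)
    (C : Set X) : Prop :=
  ∀ x ∈ C, ∀ W ∈ 𝓝 (1 : G), ∃ V : Set H, IsOpen V ∧ 0 ∈ V ∧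
    ∀ᶠ y in 𝓝[C] x, y ∈ genericShiftSet ι θ W V

theorem LocallyControlledOn.mono {X H G Y : Type*} [Add X] [TopologicalSpace X] [Zero H]
    [TopologicalSpace H] [One G] [TopologicalSpace G] [SMul G Y] {ι : H → X} {θ : X → Y}
    {C C' : Set X} (hC : LocallyControlledOn G ι θ C) (h : C' ⊆ C) :
    LocallyControlledOn G ι θ C' := fun x hx W hW =>
  let ⟨V, hV, h0, hCV⟩ := hC x (h hx) W hW
  ⟨V, hV, h0, hCV.filter_mono (nhdsWithin_mono x h)⟩

theorem add_mem_genericShiftSet {X H G Y : Type*} [AddMonoid X] [AddGroup H] [TopologicalSpace H]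
    [ContinuousAdd H] [Group G] [MulAction G Y] {ι : H →+ X} {θ : X → Y} {W M : Set G}
    {V : Set H} {x : X} (hx : x ∈ genericShiftSet ι θ M V) (hM : ∀ a ∈ M, ∀ b ∈ M, a / b ∈ W)
    {h : H} (hh : ∃ g ∈ M, θ (x + ι h) = g • θ x) :
    x + ι h ∈ genericShiftSet ι θ W ((h + ·) ⁻¹' V) := by
  obtain ⟨a, ha, hxa⟩ := hh
  filter_upwards [(tendsto_residual_of_isOpenMap (continuous_const_add h)
    (Homeomorph.addLeft h).isOpenMap).eventually hx] with k hk hkV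
  obtain ⟨b, hb, hxb⟩ := hk hkV
  exact ⟨b / a, hM b hb a ha,
    by rw [hxa, add_assoc, ← map_add, hxb, smul_smul, div_mul_cancel]⟩

variable {X H G Y : Type*} [AddGroup X] [TopologicalSpace X] [IsTopologicalAddGroup X]
  [SecondCountableTopology X] [AddGroup H] [TopologicalSpace H] [SecondCountableTopology H]
  [TopologicalSpace G] [PolishSpace G] [TopologicalSpace Y] [PolishSpace Y]
  {ι : H →+ X} {θ : X → Y}

theorem baireMeasurableSet_setOf_exists_mem_eq_smul [SMul G Y] [ContinuousSMul G Y]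
    (hι : Continuous ι) (hθ : IsBaireMeasurableMap θ) {W : Set G} (hW : IsOpen W) :
    BaireMeasurableSet {z : X × H | ∃ g ∈ W, θ (z.1 + ι z.2) = g • θ z.1} :=
  ((hθ.comp_isOpenMap continuous_fst isOpenMap_fst).prodMk
    (hθ.comp_isOpenMap (by fun_prop) (isOpenMap_add_map hι))).preimage_analyticSet
    (analyticSet_setOf_exists_mem_eq_smul hW)

variable [BaireSpace H]

theorem baireMeasurableSet_genericShiftSet [SMul G Y] [ContinuousSMul G Y] (hι : Continuous ι)
    (hθ : IsBaireMeasurableMap θ) {W : Set G} (hW : IsOpen W) {V : Set H} (hV : IsOpen V) :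
    BaireMeasurableSet (genericShiftSet ι θ W V) :=
  baireMeasurableSet_setOf_eventually_section
    (baireMeasurableSet_setOf_exists_mem_eq_smul hι hθ hW) hV

variable [ContinuousAdd H] [Group G] [IsTopologicalGroup G] [MulAction G Y] [ContinuousSMul G Y]

theorem eventually_exists_isOpen_eventually_add_mem_genericShiftSet (hι : Continuous ι)
    (hθ : IsBaireMeasurableMap θ) (hinv : ∀ x h, ∃ g : G, θ (x + ι h) = g • θ x)
    {W : Set G} (hW : W ∈ 𝓝 1) :
    ∀ᶠ x in residual X, ∀ V : Set H, IsOpen V → V.Nonempty → ∃ O, IsOpen O ∧ O.Nonempty ∧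
      ∀ᶠ h in residual H, h ∈ O → h ∈ V ∧
        ∃ b ∈ {b ∈ TopologicalSpace.countableBasis H | 0 ∈ b},
          x + ι h ∈ genericShiftSet ι θ W b := by
  obtain ⟨S, hS, hSG, hSW⟩ := exists_countable_isOpen_cover_div_mem hW
  filter_upwards [(eventually_countable_ball hS).2 fun M hM =>
    eventually_baireMeasurableSet_section
      (baireMeasurableSet_setOf_exists_mem_eq_smul hι hθ (hSW M hM).1)] with x hx V hV hVn
  set A : Set G → Set H := fun M => {h | ∃ g ∈ M, θ (x + ι h) = g • θ x}
  obtain ⟨_, ⟨M, hM, rfl⟩, O, hO, hOn, hOA⟩ := exists_isOpen_eventually_mem_of_subset_sUnion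
    (hS.image A) (forall_mem_image.2 hx) hV hVn fun h _ => by
      obtain ⟨g, hg⟩ := hinv x h
      obtain ⟨M, hM, hgM⟩ := hSG.symm ▸ mem_univ g
      exact ⟨A M, mem_image_of_mem A hM, g, hgM, hg⟩
  have hxO : x ∈ genericShiftSet ι θ M O := hOA.mono fun h hh hhO => (hh hhO).2
  refine ⟨O, hO, hOn, hOA.mono fun h hh hhO => ⟨(hh hhO).1, ?_⟩⟩
  obtain ⟨b, hb, h0b, hbO⟩ := (TopologicalSpace.isBasis_countableBasis H).exists_subset_of_mem_open
    (show (0 : H) ∈ (h + ·) ⁻¹' O by simpa using hhO) (hO.preimage (by fun_prop))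
  exact ⟨b, ⟨hb, h0b⟩, genericShiftSet_subset subset_rfl hbO
    (add_mem_genericShiftSet hxO (hSW M hM).2 (hh hhO).2)⟩

variable [BaireSpace X]

theorem eventually_exists_mem_genericShiftSet (hι : Continuous ι)
    (hθ : IsBaireMeasurableMap θ) (hinv : ∀ x h, ∃ g : G, θ (x + ι h) = g • θ x)
    {W : Set G} (hW : W ∈ 𝓝 1) (hWo : IsOpen W) :
    ∀ᶠ x in residual X, ∃ b ∈ {b ∈ TopologicalSpace.countableBasis H | 0 ∈ b},
      x ∈ genericShiftSet ι θ W b := by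
  set B := {b ∈ TopologicalSpace.countableBasis H | (0 : H) ∈ b}
  set D : Set X := {x | ∃ b ∈ B, x ∈ genericShiftSet ι θ W b} with hD
  have hDm : BaireMeasurableSet D := by
    have hDU : D = ⋃ b ∈ B, genericShiftSet ι θ W b := by ext x; simp [hD]
    rw [hDU]
    exact .biUnion ((TopologicalSpace.countable_countableBasis H).mono (sep_subset _ _))
      fun b hb => baireMeasurableSet_genericShiftSet hι hθ hWo
        (TopologicalSpace.isOpen_of_mem_countableBasis hb.1)
  by_contra hDr
  obtain ⟨U, hU, hUn, hUD⟩ := exists_isOpen_eventually_mem_of_not_isMeagre hDm.compl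
    fun hDc => hDr (by rwa [IsMeagre, compl_compl] at hDc)
  obtain ⟨x, hxU, hx, hxD⟩ := (dense_of_mem_residual
    ((eventually_exists_isOpen_eventually_add_mem_genericShiftSet hι hθ hinv hW).and
      (eventually_residual_add_map hι hUD))).inter_open_nonempty U hU hUn
  obtain ⟨O, hO, hOn, hOD⟩ := hx {h | x + ι h ∈ U} (hU.preimage (by fun_prop))
    ⟨0, by simpa using hxU⟩
  obtain ⟨h, hhO, hhD, hhU⟩ :=
    (dense_of_mem_residual (hOD.and hxD)).inter_open_nonempty O hO hOn
  exact hhU (hhD hhO).1 (hhD hhO).2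

theorem exists_residual_locallyControlledOn (hι : Continuous ι) (hθ : IsBaireMeasurableMap θ)
    (hinv : ∀ x h, ∃ g : G, θ (x + ι h) = g • θ x) :
    ∃ C ∈ residual X, LocallyControlledOn G ι θ C := by
  set BG := {W ∈ TopologicalSpace.countableBasis G | (1 : G) ∈ W}
  have hBGc : BG.Countable := (TopologicalSpace.countable_countableBasis G).mono (sep_subset _ _)
  have hBGo : ∀ W ∈ BG, IsOpen W := fun W hW =>
    TopologicalSpace.isOpen_of_mem_countableBasis hW.1
  choose! O hO hPO using fun W (hW : W ∈ BG) V (hV : V ∈ TopologicalSpace.countableBasis H) =>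
    (baireMeasurableSet_genericShiftSet hι hθ (hBGo W hW)
      (TopologicalSpace.isOpen_of_mem_countableBasis hV)).residualEq_isOpen
  have hmem := (eventually_countable_ball hBGc).2 fun W hW =>
    eventually_exists_mem_genericShiftSet hι hθ hinv ((hBGo W hW).mem_nhds hW.2) (hBGo W hW)
  have hiff := (eventually_countable_ball hBGc).2 fun W hW =>
    (eventually_countable_ball (TopologicalSpace.countable_countableBasis H)).2 fun V hV =>
      eventuallyEq_set.1 (hPO W hW V hV)
  refine ⟨_, hmem.and hiff, ?_⟩
  rintro x ⟨hxmem, hxiff⟩ W hW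
  obtain ⟨W', hW'b, hW'1, hW'⟩ :=
    (TopologicalSpace.isBasis_countableBasis G).mem_nhds_iff.1 hW
  obtain ⟨V, ⟨hV, h0V⟩, hxV⟩ := hxmem W' ⟨hW'b, hW'1⟩
  refine ⟨V, TopologicalSpace.isOpen_of_mem_countableBasis hV, h0V, ?_⟩
  filter_upwards [self_mem_nhdsWithin, mem_nhdsWithin_of_mem_nhds
    ((hO W' ⟨hW'b, hW'1⟩ V hV).mem_nhds ((hxiff W' ⟨hW'b, hW'1⟩ V hV).1 hxV))] with y hy hyO
  exact genericShiftSet_subset hW' subset_rfl ((hy.2 W' ⟨hW'b, hW'1⟩ V hV).2 hyO)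

end LocalControl

section OrbitTrace

variable {X G Y : Type*} [TopologicalSpace X]

/-- The points of `C` that `θ` sends into the part `N • y` of the orbit of `y`. -/
def orbitTrace [SMul G Y] (θ : X → Y) (C : Set X) (N : Set G) (y : Y) : Set X :=
  {x ∈ C | ∃ g ∈ N, θ x = g • y}

/-- For every `x ∈ C`, the points of `C` that `θ` sends to translates of `θ x` by elements close
to the identity of `G` are dense in a neighbourhood of `x`. -/
def LocallyOrbitDense (G : Type*) [One G] [TopologicalSpace G] [SMul G Y] (θ : X → Y)
    (C : Set X) : Prop :=
  ∀ x ∈ C, ∀ W ∈ 𝓝 (1 : G), x ∈ interior (closure (orbitTrace θ C W (θ x)))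

variable [Group G] [TopologicalSpace G] [ContinuousMul G] [MulAction G Y] {θ : X → Y} {C : Set X}

theorem LocallyOrbitDense.mem_interior_closure_orbitTrace (hC : LocallyOrbitDense G θ C) {x : X}
    (hx : x ∈ C) {g : G} {y : Y} (hxy : θ x = g • y) {N : Set G} (hN : N ∈ 𝓝 g) :
    x ∈ interior (closure (orbitTrace θ C N y)) := by
  have hW : (· * g) ⁻¹' N ∈ 𝓝 (1 : G) :=
    (continuous_mul_const g).continuousAt.preimage_mem_nhds (by rwa [one_mul])
  refine interior_mono (closure_mono ?_) (hC x hx _ hW)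
  rintro z ⟨hz, w, hw, hzw⟩
  exact ⟨hz, w * g, hw, by rw [hzw, hxy, mul_smul]⟩

/-- One half of the back-and-forth step. -/
theorem LocallyOrbitDense.exists_mem_orbitTrace (hC : LocallyOrbitDense G θ C) {x : X}
    (hx : x ∈ C) {g : G} {y y' : Y} (hxy : θ x = g • y) {M N : Set G} (hM : M ∈ 𝓝 g)
    (hxN : x ∈ interior (closure (orbitTrace θ C N y'))) {O : Set X} (hO : O ∈ 𝓝[C] x) :
    ∃ z ∈ orbitTrace θ C N y', z ∈ O ∧ z ∈ interior (closure (orbitTrace θ C M y)) := by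
  obtain ⟨U, hU, hxU, hUO⟩ := mem_nhdsWithin.1 hO
  obtain ⟨z, ⟨hzU, hzM⟩, hz⟩ := mem_closure_iff.1 (interior_subset hxN) _
    (hU.inter isOpen_interior) ⟨hxU, hC.mem_interior_closure_orbitTrace hx hxy hM⟩
  exact ⟨z, hz, hUO ⟨hzU, hz.1⟩, hzM⟩

end OrbitTrace

section BackAndForth

theorem exists_smul_eq_smul_of_dist_le_geometric {G Y : Type*} [PseudoMetricSpace G]
    [CompleteSpace G] [MetricSpace Y] [SMul G Y] [ContinuousSMul G Y] {g k : ℕ → G} {y z : Y}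
    (hg : ∀ n, dist (g n) (g (n + 1)) ≤ (1 / 2) ^ n)
    (hk : ∀ n, dist (k n) (k (n + 1)) ≤ (1 / 2) ^ n)
    (hgk : ∀ n, dist (k (n + 1) • z) (g n • y) ≤ (1 / 2) ^ n) : ∃ a b : G, b • z = a • y := by
  obtain ⟨a, ha⟩ := cauchySeq_tendsto_of_complete
    (cauchySeq_of_le_geometric (1 / 2) 1 (by norm_num) (by simpa using hg))
  obtain ⟨b, hb⟩ := cauchySeq_tendsto_of_complete
    (cauchySeq_of_le_geometric (1 / 2) 1 (by norm_num) (by simpa using hk))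
  have hdist : Tendsto (fun n => dist (k (n + 1) • z) (g n • y)) atTop (𝓝 0) :=
    squeeze_zero (fun _ => dist_nonneg) hgk
      (tendsto_pow_atTop_nhds_zero_of_lt_one (by norm_num) (by norm_num))
  exact ⟨a, b, dist_eq_zero.1 (tendsto_nhds_unique
    (((hb.comp (tendsto_add_atTop_nat 1)).smul_const z).dist (ha.smul_const y)) hdist)⟩

variable {X G Y : Type*} [TopologicalSpace X] [Group G] [MulAction G Y] {θ : X → Y} {C : Set X}

theorem LocallyOrbitDense.exists_seq_dist_lt [PseudoMetricSpace G] [ContinuousMul G]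
    [PseudoMetricSpace Y] (hC : LocallyOrbitDense G θ C) (hθ : ContinuousOn θ C) {x : X}
    (hx : x ∈ C) {y : Y} (hxy : x ∈ closure (orbitTrace θ C (univ : Set G) y)) :
    ∃ g k : ℕ → G, (∀ n, dist (g n) (g (n + 1)) < (1 / 2) ^ n) ∧
      (∀ n, dist (k n) (k (n + 1)) < (1 / 2) ^ n) ∧
      ∀ n, dist (k (n + 1) • y) (g n • θ x) < (1 / 2) ^ n := by
  set ε : ℕ → ℝ := fun n => (1 / 2) ^ n
  have hε : ∀ n, 0 < ε n := fun n => by positivity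
  set p : ℕ → X × G × G → Prop := fun n s => s.1 ∈ C ∧ θ s.1 = s.2.1 • θ x ∧
    s.1 ∈ interior (closure (orbitTrace θ C (Metric.ball s.2.2 (ε n)) y))
  obtain ⟨s₀, hs₀⟩ : ∃ s, p 0 s := by
    obtain ⟨q, hqx, hqC, k, -, hqk⟩ := mem_closure_iff.1 hxy _ isOpen_interior
      (hC.mem_interior_closure_orbitTrace hx (one_smul G (θ x)).symm
        (Metric.ball_mem_nhds 1 (hε 0)))
    obtain ⟨z, ⟨hzC, g, -, hzg⟩, -, hzk⟩ := hC.exists_mem_orbitTrace hqC hqk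
      (Metric.ball_mem_nhds k (hε 0)) hqx univ_mem
    exact ⟨(z, g, k), hzC, hzg, hzk⟩
  have hstep : ∀ n s, p n s → ∃ t, p (n + 1) t ∧ dist s.2.1 t.2.1 < ε n ∧
      dist s.2.2 t.2.2 < ε n ∧ dist (t.2.2 • y) (s.2.1 • θ x) < ε n := by
    rintro n ⟨z, g, k⟩ ⟨hz, hzg, hzk⟩
    obtain ⟨q, ⟨hq, k', hkk', hqk'⟩, hqz, hqg⟩ := hC.exists_mem_orbitTrace hz hzg
      (Metric.ball_mem_nhds g (hε n)) hzk ((hθ z hz) (Metric.ball_mem_nhds _ (hε n)))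
    obtain ⟨z', ⟨hz', g', hgg', hz'g'⟩, -, hz'k'⟩ := hC.exists_mem_orbitTrace hq hqk'
      (Metric.ball_mem_nhds k' (hε (n + 1))) hqg univ_mem
    refine ⟨(z', g', k'), ⟨hz', hz'g', hz'k'⟩, Metric.mem_ball'.1 hgg', Metric.mem_ball'.1 hkk', ?_⟩
    rw [← hqk', ← hzg]
    exact hqz
  obtain ⟨f, -, -, hf⟩ := exists_seq_of_forall_exists_step p (fun n s t =>
    dist s.2.1 t.2.1 < ε n ∧ dist s.2.2 t.2.2 < ε n ∧ dist (t.2.2 • y) (s.2.1 • θ x) < ε n)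
    hs₀ hstep
  exact ⟨fun n => (f n).2.1, fun n => (f n).2.2, fun n => (hf n).1, fun n => (hf n).2.1,
    fun n => (hf n).2.2⟩

open TopologicalSpace in
theorem LocallyOrbitDense.exists_eq_smul [TopologicalSpace G] [IsCompletelyMetrizableSpace G]
    [ContinuousMul G] [TopologicalSpace Y] [MetrizableSpace Y] [ContinuousSMul G Y]
    (hC : LocallyOrbitDense G θ C) (hθ : ContinuousOn θ C) {x : X} (hx : x ∈ C) {y : Y}
    (hxy : x ∈ closure (orbitTrace θ C (univ : Set G) y)) : ∃ g : G, θ x = g • y := by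
  let _ := upgradeIsCompletelyMetrizable G
  let _ := metrizableSpaceMetric Y
  obtain ⟨g, k, hg, hk, hgk⟩ := hC.exists_seq_dist_lt hθ hx hxy
  obtain ⟨a, b, hab⟩ := exists_smul_eq_smul_of_dist_le_geometric (fun n => (hg n).le)
    (fun n => (hk n).le) fun n => (hgk n).le
  exact ⟨a⁻¹ * b, by rw [mul_smul, hab, inv_smul_smul]⟩

end BackAndForth

section DenseShifts

theorem convex_segment_induction {E : Type*} [AddCommGroup E] [Module ℝ E] {U : Set E}
    (hU : Convex ℝ U) {p : E → Prop} {x v : E} (hx : x ∈ U) (hxv : x + v ∈ U) {n : ℕ}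
    (hn : n ≠ 0) (hpx : p x)
    (hstep : ∀ z ∈ U, z + (n : ℝ)⁻¹ • v ∈ U → p z → p (z + (n : ℝ)⁻¹ • v)) : p (x + v) := by
  have hn' : (n : ℝ) ≠ 0 := Nat.cast_ne_zero.2 hn
  have hseg : ∀ j ≤ n, x + ((j : ℝ) / n) • v ∈ U := fun j hj => by
    simpa using hU.add_smul_sub_mem hx hxv
      ⟨by positivity, div_le_one_of_le₀ (Nat.cast_le.2 hj) (by positivity)⟩
  have hsucc : ∀ j : ℕ, x + ((j : ℝ) / n) • v + (n : ℝ)⁻¹ • v = x + (((j + 1 : ℕ) : ℝ) / n) • v :=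
    fun j => by rw [add_assoc, ← add_smul, ← one_div, ← add_div, Nat.cast_succ]
  have hp : ∀ j ≤ n, p (x + ((j : ℝ) / n) • v) := by
    intro j
    induction j with
    | zero => simpa using hpx
    | succ j ih =>
      intro hj
      have hnext := hstep _ (hseg j (Nat.le_of_succ_le hj)) (hsucc j ▸ hseg (j + 1) hj)
        (ih (Nat.le_of_succ_le hj))
      rwa [hsucc] at hnext
  simpa [hn'] using hp n le_rfl

variable {X H G Y : Type*} [TopologicalSpace X] [TopologicalSpace H] [BaireSpace H]

theorem mem_closure_orbitTrace_univ [AddGroup X] [IsTopologicalAddGroup X] [SMul G Y]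
    {ι : H → X} (hι : Continuous ι) (hd : DenseRange ι) {θ : X → Y}
    (hinv : ∀ x h, ∃ g : G, θ (x + ι h) = g • θ x) {C : Set X} {x : X}
    (hx : ∀ᶠ h in residual H, x + ι h ∈ C) (z : X) :
    z ∈ closure (orbitTrace θ C (univ : Set G) (θ x)) := by
  refine mem_closure_iff.2 fun U hU hzU => ?_
  have hV : IsOpen {h | x + ι h ∈ U} := hU.preimage (by fun_prop)
  obtain ⟨h, hhU, hhC⟩ := (dense_of_mem_residual hx).inter_open_nonempty _ hV
    (hd.exists_mem_open (hU.preimage (continuous_const_add x)) ⟨-x + z, by simpa using hzU⟩)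
  obtain ⟨g, hg⟩ := hinv x h
  exact ⟨x + ι h, hhU, hhC, g, mem_univ g, hg⟩

theorem add_mem_closure_orbitTrace [Add X] [ContinuousAdd X] [Group G] [MulAction G Y]
    {ι : H → X} (hι : Continuous ι) {θ : X → Y} {C U : Set X}
    (hC : ∀ x ∈ C, ∀ᶠ h in residual H, x + ι h ∈ C) (hU : IsOpen U) {W : Subgroup G}
    {V : Set H} (hV : IsOpen V) (hW : ∀ x ∈ C ∩ U, x ∈ genericShiftSet ι θ (W : Set G) V)
    {y : Y} {z : X} (hz : z ∈ closure (orbitTrace θ (C ∩ U) (W : Set G) y)) {h : H} (hh : h ∈ V)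
    (hzh : z + ι h ∈ U) : z + ι h ∈ closure (orbitTrace θ (C ∩ U) (W : Set G) y) := by
  refine mem_closure_iff.2 fun O hO hzO => ?_
  obtain ⟨A, B, hA, hB, hzA, hhB, hAB⟩ := isOpen_prod_iff.1
    ((hO.inter hU).preimage (by fun_prop : Continuous fun q : X × H => q.1 + ι q.2)) z h
    ⟨hzO, hzh⟩
  obtain ⟨x, hxA, hx, w, hw, hxw⟩ := mem_closure_iff.1 hz A hA hzA
  obtain ⟨k, ⟨hkB, hkV⟩, hkC, hkθ⟩ :=
    (dense_of_mem_residual ((hC x hx.1).and (hW x hx))).inter_open_nonempty _ (hB.inter hV)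
      ⟨h, hhB, hh⟩
  obtain ⟨g, hg, hkg⟩ := hkθ hkV
  have hxk : x + ι k ∈ O ∩ U := hAB (mk_mem_prod hxA hkB)
  exact ⟨x + ι k, hxk.1, ⟨hkC, hxk.2⟩, g * w, W.mul_mem hg hw, by rw [hkg, hxw, mul_smul]⟩

variable [AddCommGroup X] [IsTopologicalAddGroup X] [Module ℝ X] [ContinuousConstSMul ℝ X]
  [LocallyConvexSpace ℝ X] [AddCommGroup H] [Module ℝ H] [ContinuousSMul ℝ H]
  [Group G] [TopologicalSpace G] [NonarchimedeanGroup G] [MulAction G Y] {θ : X → Y}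

theorem LocallyControlledOn.locallyOrbitDense {ι : H →L[ℝ] X} (hd : DenseRange ι) {C : Set X}
    (hCθ : LocallyControlledOn G ι θ C) (hC : ∀ x ∈ C, ∀ᶠ h in residual H, x + ι h ∈ C) :
    LocallyOrbitDense G θ C := by
  intro x hx W hW
  obtain ⟨W', hW'⟩ := NonarchimedeanGroup.is_nonarchimedean W hW
  obtain ⟨V, hV, h0V, hCV⟩ := hCθ x hx W' (W'.isOpen.mem_nhds W'.one_mem)
  obtain ⟨K, ⟨hK, hKc⟩, hKV⟩ := (LocallyConvexSpace.convex_basis (𝕜 := ℝ) x).mem_iff.1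
    (mem_nhdsWithin_iff_eventually.1 hCV)
  set U := interior K
  have hxU : x ∈ U := mem_interior_iff_mem_nhds.2 hK
  have hsub : orbitTrace θ (C ∩ U) (W' : Set G) (θ x) ⊆ orbitTrace θ C W (θ x) :=
    fun z ⟨hz, w, hw, hzw⟩ => ⟨hz.1, w, hW' hw, hzw⟩
  refine mem_interior.2 ⟨U, ?_, isOpen_interior, hxU⟩
  have hd' : Dense (range fun h => x + ι h) :=
    (Homeomorph.addLeft x).surjective.denseRange.comp hd (Homeomorph.addLeft x).continuous
  refine ((hd'.open_subset_closure_inter isOpen_interior).trans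
    (closure_minimal ?_ isClosed_closure)).trans (closure_mono hsub)
  rintro _ ⟨hhU, h, rfl⟩
  have hsmall : Tendsto (fun n : ℕ => (n : ℝ)⁻¹ • h) atTop (𝓝 0) := by
    simpa using (tendsto_inv_atTop_nhds_zero_nat (𝕜 := ℝ)).smul_const h
  obtain ⟨n, hnV, hn⟩ := ((hsmall.eventually (hV.mem_nhds h0V)).and (eventually_ne_atTop 0)).exists
  refine convex_segment_induction hKc.interior hxU hhU hn
    (subset_closure ⟨⟨hx, hxU⟩, 1, W'.one_mem, (one_smul G _).symm⟩) fun z _ hzU hz => ?_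
  rw [← map_smul] at hzU ⊢
  exact add_mem_closure_orbitTrace ι.continuous hC isOpen_interior hV
    (fun y hy => hKV (interior_subset hy.2) hy.1) hz hnV hzU

variable [BaireSpace X] [SecondCountableTopology X] [SecondCountableTopology H] [ContinuousAdd H]
  [PolishSpace G] [TopologicalSpace Y] [PolishSpace Y] [ContinuousSMul G Y]

/-- **Hjorth's turbulence theorem** for the shifts of a locally convex space by a dense
subspace. -/
theorem exists_residual_forall_exists_eq_smul (ι : H →L[ℝ] X) (hd : DenseRange ι)
    (hθ : IsBaireMeasurableMap θ) (hinv : ∀ x h, ∃ g : G, θ (x + ι h) = g • θ x) :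
    ∃ C ∈ residual X, ∀ x ∈ C, ∀ y ∈ C, ∃ g : G, θ x = g • θ y := by
  obtain ⟨R, hR, hRθ⟩ := exists_residual_locallyControlledOn (G := G) (ι := (ι : H →+ X))
    ι.continuous hθ hinv
  obtain ⟨D, hD, hDθ⟩ := hθ.exists_residual_continuousOn
  obtain ⟨C, hCr, hCsub, hC⟩ := exists_residual_subset_eventually_add_mem
    (fun _ : Unit => (ι : H →+ X)) (fun _ => ι.continuous) (inter_mem hR hD)
  have hCd : LocallyOrbitDense G θ C := LocallyControlledOn.locallyOrbitDense hd
    (hRθ.mono fun x hx => (hCsub hx).1) fun x hx => hC x hx ()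
  exact ⟨C, hCr, fun x hx y hy => hCd.exists_eq_smul (hDθ.mono fun x hx => (hCsub hx).2) hx
    (mem_closure_orbitTrace_univ ι.continuous hd hinv (hC y hy ()) x)⟩

end DenseShifts

namespace SInfty

theorem continuous_apply (n : ℕ) : Continuous fun g : SInfty => g n :=
  (_root_.continuous_apply n).comp continuous_induced_dom

theorem continuous_iff {Z : Type*} [TopologicalSpace Z] {f : Z → SInfty} :
    Continuous f ↔ ∀ n, Continuous fun z => f z n :=
  continuous_induced_rng.trans continuous_pi_iff

instance : IsTopologicalGroup SInfty where
  continuous_mul := continuous_iff.2 fun n =>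
    (continuous_prod_of_discrete_right.2 continuous_apply :
      Continuous fun p : SInfty × ℕ => p.1 p.2).comp
      (continuous_fst.prodMk ((continuous_apply n).comp continuous_snd))
  continuous_inv := continuous_iff.2 fun n => by
    refine continuous_discrete_rng.2 fun m => ?_
    have hpre : (fun g : SInfty => g⁻¹ n) ⁻¹' {m} = (fun g : SInfty => g m) ⁻¹' {n} := by
      ext g
      simp only [mem_preimage, mem_singleton_iff, Equiv.Perm.inv_eq_iff_eq]
      exact eq_comm
    rw [hpre]
    exact (isOpen_discrete _).preimage (continuous_apply m)

theorem isClosed_setOf_leftInverse :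
    IsClosed {p : (ℕ → ℕ) × (ℕ → ℕ) | Function.LeftInverse p.1 p.2} := by
  have heval : Continuous fun p : (ℕ → ℕ) × ℕ => p.1 p.2 :=
    continuous_prod_of_discrete_right.2 fun n => _root_.continuous_apply n
  simp only [Function.LeftInverse, ofPred_forall]
  exact isClosed_iInter fun n => isClosed_eq (heval.comp (continuous_fst.prodMk
    ((_root_.continuous_apply n).comp continuous_snd))) continuous_const

theorem isClosedEmbedding_prodMk_inv :
    IsClosedEmbedding fun g : SInfty => ((g, ⇑g⁻¹) : (ℕ → ℕ) × (ℕ → ℕ)) := by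
  have hcont : Continuous fun g : SInfty => ((g, ⇑g⁻¹) : (ℕ → ℕ) × (ℕ → ℕ)) :=
    (continuous_pi continuous_apply).prodMk
      (continuous_pi fun n => (continuous_apply n).comp continuous_inv)
  refine ⟨⟨IsInducing.of_comp hcont continuous_fst ⟨rfl⟩,
    fun g h hgh => DFunLike.coe_injective (congrArg Prod.fst hgh)⟩, ?_⟩
  have hrange : range (fun g : SInfty => ((g, ⇑g⁻¹) : (ℕ → ℕ) × (ℕ → ℕ))) =
      {p | Function.LeftInverse p.1 p.2} ∩ Prod.swap ⁻¹' {p | Function.LeftInverse p.1 p.2} := by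
    ext ⟨a, b⟩
    constructor
    · rintro ⟨g, hg⟩
      rw [← hg]
      exact ⟨g.apply_symm_apply, g.symm_apply_apply⟩
    · rintro ⟨hab, hba⟩
      exact ⟨⟨a, b, hba, hab⟩, rfl⟩
  rw [hrange]
  exact isClosed_setOf_leftInverse.inter (isClosed_setOf_leftInverse.preimage continuous_swap)

instance : PolishSpace SInfty :=
  isClosedEmbedding_prodMk_inv.polishSpace

theorem isOpen_fixingSubgroup_Iio (n : ℕ) :
    IsOpen (fixingSubgroup SInfty (Iio n) : Set SInfty) := by
  have hfix : (fixingSubgroup SInfty (Iio n) : Set SInfty) =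
      ⋂ i ∈ Iio n, (fun g : SInfty => g i) ⁻¹' {i} := by
    ext g
    simp [mem_fixingSubgroup_iff]
  rw [hfix]
  exact (finite_Iio n).isOpen_biInter fun i _ =>
    (isOpen_discrete _).preimage (continuous_apply i)

instance : NonarchimedeanGroup SInfty where
  is_nonarchimedean U hU := by
    rw [nhds_induced, mem_comap] at hU
    obtain ⟨V, hV, hVU⟩ := hU
    obtain ⟨_, ⟨τ, n, rfl⟩, h1, hnV⟩ :=
      (PiNat.isTopologicalBasis_cylinders (fun _ : ℕ => ℕ)).mem_nhds_iff.1 hV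
    rw [← PiNat.mem_cylinder_iff_eq.1 h1] at hnV
    exact ⟨⟨fixingSubgroup SInfty (Iio n), isOpen_fixingSubgroup_Iio n⟩, fun g hg =>
      hVU (hnV fun i hi => (mem_fixingSubgroup_iff SInfty).1 hg i hi)⟩

end SInfty

section BorelReducibility

variable {X Y Z : Type*} [TopologicalSpace X] [TopologicalSpace Y] [TopologicalSpace Z]
  {E : Setoid X} {F : Setoid Y} {R : Setoid Z}

theorem borelReducible_iff :
    BorelReducible E F ↔ ∃ θ : X → Y, IsBorelMap θ ∧ ∀ x y, E x y ↔ F (θ x) (θ y) := by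
  refine exists_congr fun θ => and_congr_right fun _ =>
    ⟨fun ⟨hθ, hinj⟩ x y => ⟨hθ x y, fun h => ?_⟩, fun h => ⟨fun x y => (h x y).1, ?_⟩⟩
  · exact Quotient.exact (hinj (Quotient.sound h))
  · rintro ⟨x⟩ ⟨y⟩ hxy
    exact Quotient.sound ((h x y).2 (Quotient.exact hxy))

theorem BorelReducible.trans (hEF : BorelReducible E F) (hFR : BorelReducible F R) :
    BorelReducible E R := by
  obtain ⟨θ, hθ, hEF⟩ := borelReducible_iff.1 hEF
  obtain ⟨η, hη, hFR⟩ := borelReducible_iff.1 hFR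
  refine borelReducible_iff.2 ⟨η ∘ θ, ?_, fun x y => (hEF x y).trans (hFR _ _)⟩
  borelize X Y Z
  exact Measurable.comp hη hθ

end BorelReducibility

section EventualEquality

theorem polishSpace_of_isGδ {X : Type*} [TopologicalSpace X] [PolishSpace X] {T : Set X}
    (hT : IsGδ T) : PolishSpace T := by
  obtain ⟨O, hO, rfl⟩ := isGδ_iff_eq_iInter_nat.1 hT
  have hpolish : ∀ n, PolishSpace (O n) := fun n => (hO n).polishSpace
  let e : ↥(⋂ n, O n) → ∀ n, O n := fun x n => ⟨x, mem_iInter.1 x.2 n⟩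
  have hval : ∀ n, Continuous fun p : ∀ n, O n => (p n : X) := fun n => by fun_prop
  have he : Continuous e := by fun_prop
  have hrange : range e = ⋂ n, {p | (p n : X) = p 0} := by
    ext p
    simp only [mem_range, mem_iInter, mem_ofPred_eq]
    constructor
    · rintro ⟨x, rfl⟩ n
      rfl
    · intro hp
      exact ⟨⟨p 0, mem_iInter.2 fun n => hp n ▸ (p n).2⟩, funext fun n => Subtype.ext (hp n).symm⟩
  have hind : IsInducing e := IsInducing.of_comp he (hval 0) IsInducing.subtypeVal
  have hinj : Function.Injective e := fun x y hxy =>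
    Subtype.ext (congrArg (fun p : ∀ n, O n => (p 0 : X)) hxy)
  refine (IsClosedEmbedding.mk ⟨hind, hinj⟩ ?_).polishSpace
  rw [hrange]
  exact isClosed_iInter fun n => isClosed_eq (hval n) (hval 0)

theorem exists_ne_zero_add_mem {X H G Y : Type*} [AddMonoid X] [TopologicalSpace X]
    [ContinuousAdd X] [AddMonoid H] [TopologicalSpace H] [T1Space H] [BaireSpace H]
    [(𝓝[≠] (0 : H)).NeBot] [SMul G Y] {ι : H →+ X} (hι : Continuous ι) {θ : X → Y}
    {C O : Set X} {W : Set G} {V : Set H} {x : X} (hC : ∀ᶠ h in residual H, x + ι h ∈ C)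
    (hO : O ∈ 𝓝 x) (hV : V ∈ 𝓝 0) (hx : x ∈ genericShiftSet ι θ W V) :
    ∃ h ≠ 0, x + ι h ∈ C ∧ x + ι h ∈ O ∧ ∃ g ∈ W, θ (x + ι h) = g • θ x := by
  have hOV : V ∩ (fun h => x + ι h) ⁻¹' O ∈ 𝓝 (0 : H) :=
    inter_mem hV ((continuous_const.add hι).continuousAt.preimage_mem_nhds (by simpa using hO))
  have hne : (interior (V ∩ (fun h => x + ι h) ⁻¹' O) ∩ {0}ᶜ).Nonempty := nonempty_of_mem
    (inter_mem (mem_nhdsWithin_of_mem_nhds (interior_mem_nhds.2 hOV)) self_mem_nhdsWithin)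
  obtain ⟨h, ⟨hhI, hh0⟩, hhC, hhW⟩ := (dense_of_mem_residual (hC.and hx)).inter_open_nonempty _
    (isOpen_interior.inter isOpen_compl_singleton) hne
  have hhVO := interior_subset hhI
  exact ⟨h, hh0, hhC, hhVO.2, hhW hhVO.1⟩

theorem eq_add_ite_of_succ_eq_add_single {A : Type*} [AddGroup A] {x : ℕ → ℕ → A} {h : ℕ → A}
    (hx : ∀ n, x (n + 1) = x n + Pi.single n (h n)) (n k : ℕ) :
    x n k = x 0 k + if k < n then h k else 0 := by
  induction n with
  | zero => simp
  | succ n ih =>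
    rw [hx, Pi.add_apply, ih]
    rcases lt_trichotomy k n with hk | rfl | hk
    · simp [hk, hk.ne, hk.trans n.lt_succ_self]
    · simp
    · simp [hk.ne', hk.not_gt, (Nat.succ_le_of_lt hk).not_gt]

variable {A G Y : Type*} [AddGroup A] [TopologicalSpace A] [IsTopologicalAddGroup A]
  [Group G] [MulAction G Y] {θ : (ℕ → A) → Y}

section Perturbation

variable [T1Space A] [BaireSpace A] [(𝓝[≠] (0 : A)).NeBot] {Z : Type*} [PseudoMetricSpace Z]
  [PseudoMetricSpace G] [ContinuousMul G] {j : Z → ℕ → A} {C : Set (ℕ → A)}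

theorem exists_seq_succ_eq_add_single (hj : IsInducing j) (hCj : C ⊆ range j)
    (hCθ : ∀ n, LocallyControlledOn G (AddMonoidHom.single (fun _ => A) n) θ C)
    (hC : ∀ x ∈ C, ∀ n, ∀ᶠ a in residual A, x + AddMonoidHom.single (fun _ => A) n a ∈ C)
    {z : Z} (hz : j z ∈ C) :
    ∃ s : ℕ → Z × G, (s 0).1 = z ∧ (∀ n, θ (j (s n).1) = (s n).2 • θ (j z)) ∧ ∀ n,
      dist (s n) (s (n + 1)) ≤ (1 / 2) ^ n ∧
        ∃ a ≠ 0, j (s (n + 1)).1 = j (s n).1 + Pi.single n a := by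
  have hstep : ∀ (n : ℕ) (s : Z × G), j s.1 ∈ C ∧ θ (j s.1) = s.2 • θ (j z) →
      ∃ t : Z × G, (j t.1 ∈ C ∧ θ (j t.1) = t.2 • θ (j z)) ∧
        dist s t ≤ (1 / 2) ^ n ∧ ∃ a ≠ 0, j t.1 = j s.1 + Pi.single n a := by
    rintro n ⟨y, g⟩ ⟨hy, hyg⟩
    have hε : (0 : ℝ) < (1 / 2) ^ n := by positivity
    obtain ⟨O, hO, hOy⟩ := mem_comap.1 (hj.nhds_eq_comap y ▸ Metric.ball_mem_nhds y hε)
    have hW : (· * g) ⁻¹' Metric.ball g ((1 / 2) ^ n) ∈ 𝓝 (1 : G) :=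
      (continuous_mul_const g).continuousAt.preimage_mem_nhds
        (by simpa only [one_mul] using Metric.ball_mem_nhds g hε)
    obtain ⟨V, hV, h0V, hyV⟩ := hCθ n _ hy _ hW
    obtain ⟨a, ha, haC, haO, w, hw, haw⟩ := exists_ne_zero_add_mem
      (ι := AddMonoidHom.single (fun _ => A) n) (continuous_single (A := fun _ => A) n)
      (hC _ hy n) hO (hV.mem_nhds h0V) (hyV.self_of_nhdsWithin hy)
    obtain ⟨y', hy'⟩ := hCj haC
    rw [← hy'] at haC haO haw
    exact ⟨(y', w * g), ⟨haC, by rw [haw, hyg, mul_smul]⟩,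
      max_le (Metric.mem_ball'.1 (hOy haO)).le (Metric.mem_ball'.1 hw).le, a, ha, hy'⟩
  obtain ⟨s, hs0, hs, hss⟩ := exists_seq_of_forall_exists_step
    (fun _ (s : Z × G) => j s.1 ∈ C ∧ θ (j s.1) = s.2 • θ (j z)) _ (a := (z, 1))
    ⟨hz, (one_smul G _).symm⟩ hstep
  exact ⟨s, by rw [hs0], fun n => (hs n).2, hss⟩

theorem exists_forall_ne_exists_eq_smul_of_isInducing [CompleteSpace Z] [CompleteSpace G]
    [TopologicalSpace Y] [T2Space Y] [ContinuousSMul G Y] (hj : IsInducing j)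
    (hθ : Continuous fun z => θ (j z)) (hCj : C ⊆ range j)
    (hCθ : ∀ n, LocallyControlledOn G (AddMonoidHom.single (fun _ => A) n) θ C)
    (hC : ∀ x ∈ C, ∀ n, ∀ᶠ a in residual A, x + AddMonoidHom.single (fun _ => A) n a ∈ C)
    {x : ℕ → A} (hx : x ∈ C) : ∃ y, (∀ k, y k ≠ x k) ∧ ∃ g : G, θ y = g • θ x := by
  obtain ⟨z, rfl⟩ := hCj hx
  obtain ⟨s, hs0, hsθ, hs⟩ := exists_seq_succ_eq_add_single hj hCj hCθ hC hx
  choose hdist a ha hsucc using hs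
  obtain ⟨⟨y, g⟩, hyg⟩ := cauchySeq_tendsto_of_complete
    (cauchySeq_of_le_geometric (1 / 2) 1 (by norm_num) (by simpa only [one_mul] using hdist))
  have hy : Tendsto (fun n => (s n).1) atTop (𝓝 y) := (continuous_fst.tendsto _).comp hyg
  have hg : Tendsto (fun n => (s n).2) atTop (𝓝 g) := (continuous_snd.tendsto _).comp hyg
  have hcoord : ∀ k, j y k = j z k + a k := fun k => by
    refine tendsto_nhds_unique
      (((continuous_apply k).comp hj.continuous).continuousAt.tendsto.comp hy) ?_
    refine tendsto_const_nhds.congr' ((eventually_gt_atTop k).mono fun n hn => ?_)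
    have hnk := eq_add_ite_of_succ_eq_add_single (x := fun n => j (s n).1) hsucc n k
    simpa only [Function.comp_apply, if_pos hn, hs0] using hnk.symm
  refine ⟨j y, fun k => by simpa [hcoord] using ha k, g,
    tendsto_nhds_unique ((hθ.tendsto y).comp hy) ?_⟩
  simpa only [Function.comp_def, hsθ] using hg.smul_const (θ (j z))

end Perturbation

variable [PolishSpace A] [(𝓝[≠] (0 : A)).NeBot] [TopologicalSpace G] [IsTopologicalGroup G]
  [PolishSpace G] [TopologicalSpace Y] [PolishSpace Y] [ContinuousSMul G Y]

open TopologicalSpace in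
theorem IsBaireMeasurableMap.exists_forall_ne_exists_eq_smul (hθ : IsBaireMeasurableMap θ)
    (hinv : ∀ n x a, ∃ g : G, θ (x + Pi.single n a) = g • θ x) :
    ∃ x y : ℕ → A, (∀ k, y k ≠ x k) ∧ ∃ g : G, θ y = g • θ x := by
  choose R hR hRθ using fun n => exists_residual_locallyControlledOn (G := G)
    (ι := AddMonoidHom.single (fun _ => A) n) (continuous_single (A := fun _ => A) n) hθ (hinv n)
  obtain ⟨D, hD, hDθ⟩ := hθ.exists_residual_continuousOn
  obtain ⟨T, hTsub, hTG, hTd⟩ := mem_residual.1 (inter_mem hD (countable_iInter_mem.2 hR))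
  obtain ⟨C, hCr, hCT, hC⟩ := exists_residual_subset_eventually_add_mem
    (fun n => AddMonoidHom.single (fun _ : ℕ => A) n) continuous_single
    (residual_of_dense_Gδ hTG hTd)
  obtain ⟨x, hx⟩ := (dense_of_mem_residual hCr).nonempty
  have := polishSpace_of_isGδ hTG
  let _ := upgradeIsCompletelyMetrizable G
  let _ := upgradeIsCompletelyMetrizable T
  exact ⟨x, exists_forall_ne_exists_eq_smul_of_isInducing IsInducing.subtypeVal
    (hDθ.mono fun x hx => (hTsub hx).1).domRestrict (hCT.trans_eq Subtype.range_coe.symm)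
    (fun n => (hRθ n).mono fun x hx => mem_iInter.1 (hTsub (hCT hx)).2 n) hC hx⟩

/-- The **Kechris–Louveau theorem** on the relation `E₁`. -/
theorem not_borelReducible_germSetoid_orbitRel :
    ¬ BorelReducible (germSetoid atTop A : Setoid (ℕ → A)) (MulAction.orbitRel G Y) := by
  intro h
  obtain ⟨θ, hθ, hred⟩ := borelReducible_iff.1 h
  have hiff : ∀ x y : ℕ → A, x =ᶠ[atTop] y ↔ ∃ g : G, θ x = g • θ y := fun x y =>
    (hred x y).trans (exists_congr fun _ => eq_comm)
  obtain ⟨x, y, hxy, hθxy⟩ := hθ.isBaireMeasurableMap.exists_forall_ne_exists_eq_smul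
    fun n x a => (hiff _ x).1 <| (eventually_gt_atTop n).mono fun m hm => by
      simp [hm.ne']
  obtain ⟨k, hk⟩ := ((hiff y x).2 hθxy).exists
  exact hxy k hk

end EventualEquality

section RealFunctions

instance : BaireSpace C(ℝ, ℝ) := by
  have : (𝓤 C(ℝ, ℝ)).IsCountablyGenerated := inferInstance
  infer_instance

theorem finiteDistRel_supMetric_iff {f g : C(ℝ, ℝ)} :
    supMetric.finiteDistRel f g ↔ ∃ K : ℝ, ∀ t, |f t - g t| ≤ K := by
  change (⨆ t : ℝ, ENNReal.ofReal |f t - g t|) < ∞ ↔ _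
  constructor
  · intro h
    exact ⟨_, fun t => (ENNReal.ofReal_le_iff_le_toReal h.ne).1
      (le_iSup (fun t : ℝ => ENNReal.ofReal |f t - g t|) t)⟩
  · rintro ⟨K, hK⟩
    exact (iSup_le fun t => ENNReal.ofReal_le_ofReal (hK t)).trans_lt ENNReal.ofReal_lt_top

theorem exists_pos_forall_abs_sub_le_imp_mem {V : Set (C(ℝ, ℝ) × C(ℝ, ℝ))}
    (hV : V ∈ 𝓤[supMetric.toUniformSpace]) :
    ∃ δ > 0, ∀ f g : C(ℝ, ℝ), (∀ t, |f t - g t| ≤ δ) → (f, g) ∈ V := by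
  obtain ⟨ε, hε, hεV⟩ := (@mem_uniformity_edist _ supMetric.toPseudoEMetricSpace _).1 hV
  obtain ⟨δ, -, hδ, hδε⟩ := ENNReal.lt_iff_exists_real_btwn.1 hε
  exact ⟨δ, ENNReal.ofReal_pos.1 hδ, fun f g hfg =>
    hεV ((iSup_le fun t => ENNReal.ofReal_le_ofReal (hfg t)).trans_lt hδε)⟩

/-- The restriction to `ℝ` of continuous functions on the extended real line. Since `EReal` is
compact, its source is a Banach space and its values are bounded functions. -/
noncomputable def restrictReal : C(EReal, ℝ) →L[ℝ] C(ℝ, ℝ) where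
  toFun h := h.comp ⟨Real.toEReal, continuous_coe_real_ereal⟩
  map_add' _ _ := rfl
  map_smul' _ _ := rfl
  cont := ContinuousMap.continuous_precomp _

theorem finiteDistRel_add_restrictReal (f : C(ℝ, ℝ)) (h : C(EReal, ℝ)) :
    supMetric.finiteDistRel f (f + restrictReal h) :=
  finiteDistRel_supMetric_iff.2 ⟨‖h‖, fun t => by
    simpa [restrictReal] using h.norm_coe_le_norm t⟩

theorem tendsto_continuousMap_of_eqOn_Icc {E : Type*} [TopologicalSpace E] {F : ℕ → C(ℝ, E)}
    {f : C(ℝ, E)} (h : ∀ n : ℕ, EqOn (F n) f (Icc (-n) n)) : Tendsto F atTop (𝓝 f) := by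
  refine ContinuousMap.tendsto_nhds_compactOpen.2 fun K hK U _ hf => ?_
  obtain ⟨r, hr⟩ := hK.isBounded.subset_closedBall 0
  filter_upwards [eventually_ge_atTop ⌈r⌉₊] with n hn t ht
  have htn : |t| ≤ n := (mem_closedBall_zero_iff.1 (hr ht)).trans (Nat.ceil_le.1 hn)
  rw [h n (abs_le.1 htn)]
  exact hf ht

theorem denseRange_restrictReal : DenseRange restrictReal := by
  intro f
  have hext : ∀ n : ℕ, ∃ h : C(EReal, ℝ), EqOn (restrictReal h) f (Icc (-n) n) := by
    intro n
    have he : IsClosedEmbedding fun t : Icc (-n : ℝ) n => ((t : ℝ) : EReal) :=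
      Continuous.isClosedEmbedding
        (continuous_coe_real_ereal.comp continuous_subtype_val) fun s t hst =>
        Subtype.ext (EReal.coe_injective hst)
    obtain ⟨h, hh⟩ := (f.restrict (Icc (-n : ℝ) n)).exists_extension he
    exact ⟨h, fun t ht => DFunLike.congr_fun hh ⟨t, ht⟩⟩
  choose h hh using hext
  exact mem_closure_of_tendsto (tendsto_continuousMap_of_eqOn_Icc hh)
    (.of_forall fun n => mem_range_self _)

end RealFunctions

section Turbulence

theorem dense_setOf_finiteDistRel (f : C(ℝ, ℝ)) : Dense {g | supMetric.finiteDistRel f g} := by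
  have h : DenseRange fun h => f + restrictReal h :=
    (Homeomorph.addLeft f).surjective.denseRange.comp denseRange_restrictReal
      (Homeomorph.addLeft f).continuous
  exact h.mono (range_subset_iff.2 (finiteDistRel_add_restrictReal f))

theorem not_finiteDistRel_add_id (f : C(ℝ, ℝ)) :
    ¬ supMetric.finiteDistRel f (f + ContinuousMap.id ℝ) := by
  intro h
  obtain ⟨K, hK⟩ := finiteDistRel_supMetric_iff.1 h
  have hK' := hK (|K| + 1)
  rw [ContinuousMap.add_apply, ContinuousMap.id_apply, sub_add_cancel_left, abs_neg,
    abs_of_nonneg (by positivity)] at hK'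
  linarith [le_abs_self K]

theorem isMeagre_setOf_finiteDistRel (f : C(ℝ, ℝ)) :
    IsMeagre {g | supMetric.finiteDistRel f g} := by
  have hclosed : ∀ n : ℕ, IsClosed {g : C(ℝ, ℝ) | ∀ t, |f t - g t| ≤ n} := fun n => by
    simp only [ofPred_forall]
    exact isClosed_iInter fun t => isClosed_le
      (continuous_const.sub (ContinuousEvalConst.continuous_eval_const t)).abs continuous_const
  -- The class of `f + id` is dense and disjoint from the class of `f`.
  have hint : ∀ n : ℕ, interior {g : C(ℝ, ℝ) | ∀ t, |f t - g t| ≤ n} = ∅ := by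
    refine fun n => interior_eq_empty_iff_dense_compl.2
      ((dense_setOf_finiteDistRel (f + ContinuousMap.id ℝ)).mono ?_)
    intro g hg (hfg : ∀ t, |f t - g t| ≤ n)
    exact not_finiteDistRel_add_id f (supMetric.finiteDistRel.trans
      (finiteDistRel_supMetric_iff.2 ⟨n, hfg⟩) (supMetric.finiteDistRel.symm hg))
  refine (isMeagre_iUnion fun n : ℕ => ((hclosed n).isNowhereDense_iff.2 (hint n)).isMeagre).mono
    fun g hg => ?_
  obtain ⟨K, hK⟩ := finiteDistRel_supMetric_iff.1 hg
  obtain ⟨n, hn⟩ := exists_nat_ge K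
  exact mem_iUnion.2 ⟨n, fun t => (hK t).trans hn⟩

theorem localClass_mono {X : Type*} {V : Set (X × X)} {S U : Set X} (hSU : S ⊆ U) (x : X) :
    localClass V S x ⊆ localClass V U x :=
  Relation.ReflTransGen.mono (fun _ _ h => ⟨h.1, hSU h.2.1, hSU h.2.2⟩) x

theorem inter_setOf_finiteDistRel_subset_localClass {U : Set C(ℝ, ℝ)} (hU : Convex ℝ U)
    {V : Set (C(ℝ, ℝ) × C(ℝ, ℝ))} (hV : V ∈ 𝓤[supMetric.toUniformSpace]) {f : C(ℝ, ℝ)}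
    (hf : f ∈ U) : U ∩ {g | supMetric.finiteDistRel f g} ⊆ localClass V U f := by
  rintro g ⟨hg, hfg⟩
  obtain ⟨δ, hδ, hδV⟩ := exists_pos_forall_abs_sub_le_imp_mem hV
  obtain ⟨K, hK⟩ := finiteDistRel_supMetric_iff.1 hfg
  obtain ⟨n, hn⟩ := exists_nat_gt (max 0 (K / δ))
  have hn0 : (0 : ℝ) < n := (le_max_left _ _).trans_lt hn
  have hKn : K ≤ n * δ := ((div_lt_iff₀ hδ).1 ((le_max_right _ _).trans_lt hn)).le
  rw [← add_sub_cancel f g] at hg ⊢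
  refine convex_segment_induction (p := (· ∈ localClass V U f)) hU hf hg
    (Nat.cast_pos.1 hn0).ne' .refl fun h hh hh' hhf => hhf.tail ⟨hδV _ _ fun t => ?_, hh, hh'⟩
  have hstep : h t - (h + (n : ℝ)⁻¹ • (g - f)) t = (n : ℝ)⁻¹ * (f t - g t) := by
    simp only [ContinuousMap.add_apply, ContinuousMap.smul_apply, ContinuousMap.sub_apply,
      smul_eq_mul]
    ring
  rw [hstep, abs_mul, abs_of_pos (inv_pos.2 hn0), inv_mul_le_iff₀ hn0]
  exact (hK t).trans hKn

theorem isTurbulent_supMetric : supMetric.toUniformRelation.IsTurbulent where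
  dense_class := dense_setOf_finiteDistRel
  meagre_class := isMeagre_setOf_finiteDistRel
  somewhere_dense_localClass U V hU hV _ f hf := by
    obtain ⟨S, ⟨hS, hSc⟩, hSU⟩ :=
      (LocallyConvexSpace.convex_basis (𝕜 := ℝ) f).mem_iff.1 (hU.mem_nhds hf)
    have hlocal : interior S ∩ {g | supMetric.finiteDistRel f g} ⊆ localClass V U f :=
      (inter_subset_inter_left _ interior_subset).trans
        ((inter_setOf_finiteDistRel_subset_localClass hSc hV (mem_of_mem_nhds hS)).trans
          (localClass_mono hSU f))
    exact ⟨f, interior_maximal (((dense_setOf_finiteDistRel f).open_subset_closure_inter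
      isOpen_interior).trans (closure_mono hlocal)) isOpen_interior
      (mem_interior_iff_mem_nhds.2 hS)⟩

end Turbulence

section GenericErgodicity

theorem genericallyErgodic_of_forall_exists_residual {X Y : Type*} [TopologicalSpace X]
    [TopologicalSpace Y] {E : Setoid X} {F : Setoid Y}
    (h : ∀ θ : X → Y, IsInvariantMap E F θ → IsBaireMeasurableMap θ →
      ∃ C ∈ residual X, ∀ x ∈ C, ∀ y ∈ C, F (θ x) (θ y)) : GenericallyErgodic E F := by
  intro θ hinv hθ
  obtain ⟨C, hC, hCθ⟩ := h θ hinv hθ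
  refine ⟨{x | ∃ c ∈ C, E c x}, mem_of_superset hC fun c hc => ⟨c, hc, E.refl c⟩, ?_, ?_⟩
  · rintro x ⟨c, hc, hcx⟩ y hxy
    exact ⟨c, hc, E.trans hcx hxy⟩
  · rintro x ⟨c, hc, hcx⟩ y ⟨d, hd, hdy⟩
    exact F.trans (F.symm (hinv _ _ hcx)) (F.trans (hCθ c hc d hd) (hinv _ _ hdy))

theorem genericallyErgodic_finiteDistRel_orbitRel {G Y : Type*} [Group G] [TopologicalSpace G]
    [NonarchimedeanGroup G] [PolishSpace G] [TopologicalSpace Y] [PolishSpace Y] [MulAction G Y]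
    [ContinuousSMul G Y] :
    GenericallyErgodic supMetric.finiteDistRel (MulAction.orbitRel G Y) := by
  refine genericallyErgodic_of_forall_exists_residual fun θ hinv hθ => ?_
  obtain ⟨C, hC, hCθ⟩ := exists_residual_forall_exists_eq_smul (G := G) restrictReal
    denseRange_restrictReal hθ fun f h =>
      (hinv _ _ (supMetric.finiteDistRel.symm (finiteDistRel_add_restrictReal f h))).imp
        fun _ => Eq.symm
  exact ⟨C, hC, fun x hx y hy => (hCθ x hx y hy).imp fun _ => Eq.symm⟩

end GenericErgodicity

section BoundedDifference

/-- The tent of height `1` supported by `[-1/2, 1/2]`. -/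
noncomputable def tent (t : ℝ) : ℝ := max 0 (1 - 2 * |t|)

@[fun_prop]
theorem continuous_tent : Continuous tent := by
  unfold tent
  fun_prop

theorem tent_zero : tent 0 = 1 := by simp [tent]

theorem tent_nonneg (t : ℝ) : 0 ≤ tent t := le_max_left _ _

theorem tent_le_one (t : ℝ) : tent t ≤ 1 :=
  max_le zero_le_one (by linarith [abs_nonneg t])

theorem abs_lt_half_of_tent_ne_zero {t : ℝ} (ht : tent t ≠ 0) : |t| < 1 / 2 := by
  contrapose! ht
  exact max_eq_left (by linarith)

theorem locallyFinite_support_tent_sub_natCast :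
    LocallyFinite fun i : ℕ => Function.support fun t : ℝ => tent (t - i) := by
  intro t
  refine ⟨Metric.ball t 1, Metric.ball_mem_nhds _ one_pos, (finite_Iic ⌈t + 2⌉₊).subset ?_⟩
  rintro i ⟨s, hsi, hst⟩
  have hsi' := abs_lt.1 (abs_lt_half_of_tent_ne_zero hsi)
  have hst' := abs_lt.1 (Real.dist_eq s t ▸ Metric.mem_ball.1 hst)
  exact Nat.cast_le.1 ((by linarith [hsi'.1, hst'.2] : (i : ℝ) ≤ t + 2).trans (Nat.le_ceil _))

/-- The continuous function that takes the value `u i` at `i`, with disjoint tents around the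
natural numbers. -/
noncomputable def tentSum : C(ℕ → ℝ, C(ℝ, ℝ)) :=
  ContinuousMap.curry
    ⟨fun p => ∑ᶠ i, p.1 i * tent (p.2 - i), continuous_finsum (fun i => by fun_prop)
      ((locallyFinite_support_tent_sub_natCast.preimage_continuous continuous_snd).subset
        fun _ _ hp => right_ne_zero_of_mul hp)⟩

theorem tentSum_apply (u : ℕ → ℝ) (t : ℝ) :
    tentSum u t = u ⌊t + 1 / 2⌋₊ * tent (t - ⌊t + 1 / 2⌋₊) := by
  refine finsum_eq_single _ _ fun i hi => mul_eq_zero_of_right _ ?_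
  contrapose! hi
  have hti := abs_lt.1 (abs_lt_half_of_tent_ne_zero hi)
  exact ((Nat.floor_eq_iff (by linarith [hti.1, i.cast_nonneg (α := ℝ)])).2
    ⟨by linarith [hti.1], by linarith [hti.2]⟩).symm

theorem tentSum_natCast (u : ℕ → ℝ) (i : ℕ) : tentSum u i = u i := by
  have hi : ⌊(i : ℝ) + 1 / 2⌋₊ = i :=
    (Nat.floor_eq_iff (by positivity)).2 ⟨by linarith, by linarith⟩
  rw [tentSum_apply, hi, sub_self, tent_zero, mul_one]

theorem finiteDistRel_tentSum_iff {u v : ℕ → ℝ} :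
    supMetric.finiteDistRel (tentSum u) (tentSum v) ↔ ∃ K : ℝ, ∀ i, |u i - v i| ≤ K := by
  rw [finiteDistRel_supMetric_iff]
  refine exists_congr fun K => ⟨fun hK i => ?_, fun hK t => ?_⟩
  · simpa only [tentSum_natCast] using hK i
  · rw [tentSum_apply, tentSum_apply, ← sub_mul, abs_mul, abs_of_nonneg (tent_nonneg _)]
    exact (mul_le_of_le_one_right (abs_nonneg _) (tent_le_one _)).trans (hK _)

end BoundedDifference

section Reduction

theorem exists_nat_mul_abs_sub_rat_le_one {a b : ℝ} (hab : a ≠ b) (M : ℝ) :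
    ∃ (q : ℚ) (k : ℕ), k * |a - q| ≤ 1 ∧ M ≤ k * |b - q| := by
  have hd : 0 < |a - b| := abs_pos.2 (sub_ne_zero.2 hab)
  obtain ⟨k, hk⟩ := exists_nat_gt (max 0 ((M + 1) / |a - b|))
  have hk0 : (0 : ℝ) < k := (le_max_left _ _).trans_lt hk
  have hkM : M + 1 < k * |a - b| := (div_lt_iff₀ hd).1 ((le_max_right _ _).trans_lt hk)
  obtain ⟨q, haq, hqa⟩ := exists_rat_btwn (lt_add_of_pos_right a (inv_pos.2 hk0))
  have hq : k * |a - q| ≤ 1 := by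
    rw [← le_div_iff₀' hk0, one_div, abs_sub_comm, abs_of_pos (sub_pos.2 haq)]
    linarith
  refine ⟨q, k, hq, ?_⟩
  have htriangle : |a - b| ≤ |a - q| + |b - q| := abs_sub_comm b q ▸ abs_sub_le a q b
  linarith [mul_le_mul_of_nonneg_left htriangle hk0.le, mul_add (k : ℝ) |a - q| |b - q|]

/-- The distance of the `m`-th term of a sequence from the rational number `q`, magnified `k`
times and truncated at `m`, for `e = (m, q, k)`. Two sequences are eventually equal if and only if
these quantities differ by a bounded amount. -/
noncomputable def truncatedDist (e : ℕ × ℚ × ℕ) (x : ℕ → ℝ) : ℝ :=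
  min (e.1 : ℝ) (e.2.2 * |x e.1 - e.2.1|)

@[fun_prop]
theorem continuous_truncatedDist (e : ℕ × ℚ × ℕ) : Continuous (truncatedDist e) := by
  unfold truncatedDist
  fun_prop

theorem truncatedDist_mem_Icc (e : ℕ × ℚ × ℕ) (x : ℕ → ℝ) :
    truncatedDist e x ∈ Icc (0 : ℝ) e.1 :=
  ⟨le_min (by positivity) (by positivity), min_le_left _ _⟩

theorem abs_truncatedDist_sub_le_of_eqOn {x y : ℕ → ℝ} {n : ℕ} (h : ∀ m ≥ n, x m = y m)
    (e : ℕ × ℚ × ℕ) : |truncatedDist e x - truncatedDist e y| ≤ n := by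
  rcases le_or_gt n e.1 with hn | hn
  · simp [truncatedDist, h _ hn]
  · have hx := truncatedDist_mem_Icc e x
    have hy := truncatedDist_mem_Icc e y
    exact (abs_sub_le_of_nonneg_of_le hx.1 hx.2 hy.1 hy.2).trans (by exact_mod_cast hn.le)

theorem eventuallyEq_iff_exists_abs_truncatedDist_sub_le {x y : ℕ → ℝ} :
    x =ᶠ[atTop] y ↔ ∃ K : ℝ, ∀ e, |truncatedDist e x - truncatedDist e y| ≤ K := by
  constructor
  · intro hxy
    obtain ⟨n, hn⟩ := eventually_atTop.1 hxy
    exact ⟨n, abs_truncatedDist_sub_le_of_eqOn hn⟩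
  · rintro ⟨K, hK⟩
    filter_upwards [tendsto_natCast_atTop_atTop.eventually_gt_atTop (K + 1)] with m hm
    by_contra hne
    obtain ⟨q, k, hxq, hyq⟩ := exists_nat_mul_abs_sub_rat_le_one hne m
    have hx : truncatedDist (m, q, k) x ≤ 1 := (min_le_right _ _).trans hxq
    have hy : truncatedDist (m, q, k) y = m := min_eq_left hyq
    linarith [(abs_le.1 (hK (m, q, k))).1]

theorem borelReducible_germSetoid_finiteDistRel :
    BorelReducible (germSetoid atTop ℝ : Setoid (ℕ → ℝ)) supMetric.finiteDistRel := by
  obtain ⟨e, he⟩ := exists_surjective_nat (ℕ × ℚ × ℕ)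
  refine borelReducible_iff.2 ⟨fun x => tentSum fun i => truncatedDist (e i) x, ?_, fun x y => ?_⟩
  · borelize (ℕ → ℝ) C(ℝ, ℝ)
    exact Continuous.measurable (by fun_prop)
  · rw [finiteDistRel_tentSum_iff]
    exact eventuallyEq_iff_exists_abs_truncatedDist_sub_le.trans
      (exists_congr fun K => he.forall)

theorem not_borelReducible_finiteDistRel_orbitRel {G Y : Type*} [Group G] [TopologicalSpace G]
    [IsTopologicalGroup G] [PolishSpace G] [TopologicalSpace Y] [PolishSpace Y] [MulAction G Y]
    [ContinuousSMul G Y] :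
    ¬ BorelReducible supMetric.finiteDistRel (MulAction.orbitRel G Y) := fun h =>
  not_borelReducible_germSetoid_orbitRel (borelReducible_germSetoid_finiteDistRel.trans h)

end Reduction

theorem theoremt_general :
    supMetric.toUniformRelation.IsTurbulent ∧
    (∀ (G : Type*) [Group G] [TopologicalSpace G] [NonarchimedeanGroup G] [PolishSpace G]
        (Y : Type*) [TopologicalSpace Y] [PolishSpace Y] [MulAction G Y] [ContinuousSMul G Y],
      GenericallyErgodic supMetric.finiteDistRel (MulAction.orbitRel G Y)) ∧
    (∀ (G : Type*) [Group G] [TopologicalSpace G] [IsTopologicalGroup G] [PolishSpace G]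
        (Y : Type*) [TopologicalSpace Y] [PolishSpace Y] [MulAction G Y] [ContinuousSMul G Y],
      ¬ BorelReducible supMetric.finiteDistRel (MulAction.orbitRel G Y)) :=
  ⟨isTurbulent_supMetric, fun _ _ _ _ _ _ _ _ _ _ => genericallyErgodic_finiteDistRel_orbitRel,
    fun _ _ _ _ _ _ _ _ _ _ => not_borelReducible_finiteDistRel_orbitRel⟩

theorem theoremt :
    supMetric.toUniformRelation.IsTurbulent ∧
    (∀ (Y : Type*) [TopologicalSpace Y] [PolishSpace Y] [MulAction SInfty Y]
        [ContinuousSMul SInfty Y],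
      GenericallyErgodic supMetric.finiteDistRel (MulAction.orbitRel SInfty Y)) ∧
    (∀ (G : Type*) [Group G] [TopologicalSpace G] [IsTopologicalGroup G] [PolishSpace G]
        (Y : Type*) [TopologicalSpace Y] [PolishSpace Y] [MulAction G Y] [ContinuousSMul G Y],
      ¬ BorelReducible supMetric.finiteDistRel (MulAction.orbitRel G Y)) :=
  theoremt_general.imp_right (And.imp_left fun h => h SInfty)
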